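/- Consider the system $x_{t+1}=\theta_*\phi(x_t,u_t)+w_t$, $x_0=0$, with $x_t,w_t\in\mathbb R^{n_x}$, $u_t\in\mathbb R^{n_u}$, $\theta_*\in\mathbb R^{n_x\times n_\phi}$, whose feature functions $\phi^1,\dots,\phi^{n_\phi}:\mathbb R^{n_x+n_u}\to\mathbb R$ are real-analytic and linearly independent. The inputs are $u_t=\pi(x_t)+\eta_t$ with $\pi:\mathbb R^{n_x}\to\mathbb R^{n_u}$ real-analytic. Assume: (a) $(w_t)_{t\ge0}$ is i.i.d. with mean zero, covariance $\Sigma_w\succeq\sigma_w^2I$ for some $\sigma_w>0$, $\|w_t\|_\infty\le w_{\max}$ almost surely, and a semi-continuous law, i.e. no Lebesgue-null set has probability one under it; $(\eta_t)_{t\ge0}$ has the same properties with constants $\sigma_u>0$ and $u_{\max}$; the two sequences are independent of each other. (b) The closed loop $x_{t+1}=f(x_t,d_t)=\theta_*\phi(x_t,\pi(x_t)+\eta_t)+w_t$ with input $d_t=(w_t,\eta_t)$ is locally input-to-state stable (LISS): $f$ is continuous, $f(0,0)=0$, and there are $\rho_x>0$, $\rho>0$ with $\rho\ge\max(w_{\max},u_{\max})$,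 $\gamma\in\mathcal K$ and $\beta\in\mathcal{KL}$ such that $\|x_t\|_2\le\beta(\|x_0\|_2,t)+\gamma(\sup_j\|d_j\|_\infty)$ for all $t\ge0$, all initial states with $\|x_0\|_2\le\rho_x$ and all deterministic inputs with $\sup_j\|d_j\|_\infty\le\rho$. Let $\mathcal F_t$ be the $\sigma$-algebra generated by $w_0,\dots,w_{t-1}$, $x_0,\dots,x_t$, $\pi(x_0),\dots,\pi(x_t)$, $\eta_0,\dots,\eta_t$, and let $\bar b_\phi=\sup_{t\ge0}\mathbb E\|\phi(x_t,u_t)\|_2^2$. Say that $(s,p)$ is a BMSB pair if $s>0$, $p\in(0,1)$ and the $(\mathcal F_t)_{t\ge1}$-adapted process $(\phi(x_t,u_t))_{t\ge1}$ satisfies the $(1,s^2I_{n_\phi},p)$-block martingale small-ball condition: for every unit vector $v\in\mathbb R^{n_\phi}$ and every $t\ge1$, $\mathbb P(|v^\top\phi(x_{t+1},u_{t+1})|\ge s\mid\mathcal F_t)\ge p$ almost surely. For $\sigma>0$, say that the LSE rate holds with $(s,p,\sigma)$ if for all $\delta\in(0,1)$ and all integers $T\ge1$ with $$T\ge\frac{10}{p}\Big(\log\frac1\delta+2n_\phi\log\frac{10}{p}+n_\phi\log\frac{\bar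 b_\phi}{\delta s^2}\Big),$$ with probability at least $1-3\delta$ every least squares estimate $\hat\theta_T\in\arg\min_{\hat\theta}\sum_{t=0}^{T-1}\|x_{t+1}-\hat\theta\phi(x_t,u_t)\|_2^2$ satisfies, in the largest-singular-value norm, $$\|\hat\theta_T-\theta_*\|_2\le\frac{90\,\sigma}{p}\sqrt{\frac{n_x+\log\frac1\delta+n_\phi\log\frac{10}{p}+n_\phi\log\frac{\bar b_\phi}{\delta s^2}}{T s^2}}.$$ Then: 1. $\mathbb E\|\phi(x_t,u_t)\|_2^2<\infty$ for all $t$, and $\bar b_\phi<\infty$. 2. There is a BMSB pair $(s_\phi,p_\phi)$ such that the LSE rate holds with $(s_\phi,p_\phi,\sigma_w)$. 3. For every BMSB pair $(s,p)$ and every $\sigma>0$ such that $w_t$ is $\sigma^2$-sub-Gaussian, i.e. $\mathbb E\,e^{r v^\top w_t}\le e^{\sigma^2r^2/2}$ for all unit $v\in\mathbb R^{n_x}$ and all $r\in\mathbb R$, the LSE rate holds with $(s,p,\sigma)$. -/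

import Mathlib

open MeasureTheory ProbabilityTheory Filter Topology
open scoped NNReal ENNReal Matrix Matrix.Norms.L2Operator

/-- `ℝⁿ` with the Euclidean norm. -/
abbrev Vec (n : ℕ) : Type := EuclideanSpace ℝ (Fin n)

/-- The feature vector `φ(x, u) = (φ¹(x, u), …, φᵐ(x, u))ᵀ`. -/
def featureVec {nx nu m : ℕ} (φ : Fin m → Vec nx × Vec nu → ℝ) (x : Vec nx) (u : Vec nu) :
    Vec m :=
  WithLp.toLp 2 (fun i => φ i (x, u))

/-- The matrix-vector product `θ y` between Euclidean spaces. -/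
def matVec {n m : ℕ} (θ : Matrix (Fin n) (Fin m) ℝ) (y : Vec m) : Vec n :=
  WithLp.toLp 2 (θ *ᵥ y.ofLp)

/-! ### Distributional assumptions -/

/-- A probability distribution on `ℝⁿ` is semi-continuous if no Lebesgue-null set has
probability one. -/
def SemiContinuousLaw {n : ℕ} (P : Measure (Vec n)) : Prop :=
  ¬ ∃ E : Set (Vec n), volume E = 0 ∧ P E = 1

/-- The covariance matrix of a random vector. -/
noncomputable def covMatrix {Ω : Type*} [MeasurableSpace Ω] (μ : Measure Ω) {n : ℕ}
    (X : Ω → Vec n) : Matrix (Fin n) (Fin n) ℝ :=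
  Matrix.of fun i j => cov[fun ω => X ω i, fun ω => X ω j; μ]

/-- `ξ 0, ξ 1, …` are i.i.d. with a semi-continuous law of mean zero, with covariance matrix
`Σ ⪰ σ² I ≻ 0`, and `‖ξ t‖_∞ ≤ B` almost surely. -/
structure BoundedIIDSemiContinuous {Ω : Type*} [MeasurableSpace Ω] (μ : Measure Ω) {n : ℕ}
    (ξ : ℕ → Ω → Vec n) (σ B : ℝ) : Prop where
  measurable : ∀ t, Measurable (ξ t)
  indep : iIndepFun ξ μ
  identDistrib : ∀ t, IdentDistrib (ξ t) (ξ 0) μ μ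
  semiContinuous : ∀ t, SemiContinuousLaw (μ.map (ξ t))
  mean_zero : ∀ t, ∫ ω, ξ t ω ∂μ = 0
  sigma_pos : 0 < σ
  cov_ge : ∀ t, (covMatrix μ (ξ t) - σ ^ 2 • (1 : Matrix (Fin n) (Fin n) ℝ)).PosSemidef
  bounded : ∀ t, ∀ᵐ ω ∂μ, ∀ i, |ξ t ω i| ≤ B

/-- A random vector `X` is `σ²`-sub-Gaussian:
`E exp(r vᵀX) ≤ exp(σ² r² / 2)` for all unit vectors `v` and all real `r`. -/
def SubgaussianVec {Ω : Type*} [MeasurableSpace Ω] (μ : Measure Ω) {n : ℕ}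
    (X : Ω → Vec n) (σ : ℝ) : Prop :=
  ∀ v : Vec n, ‖v‖ = 1 → HasSubgaussianMGF (fun ω => inner ℝ v (X ω)) (Real.toNNReal (σ ^ 2)) μ

/-! ### Local input-to-state stability -/

/-- The trajectory of `x_{t+1} = f(x_t, d_t)` started at `x₀`. -/
def trajectory {X D : Type*} (f : X → D → X) (x₀ : X) (d : ℕ → D) : ℕ → X
  | 0 => x₀
  | t + 1 => f (trajectory f x₀ d t) (d t)

/-- Class `𝒦` functions. -/
structure ClassK (γ : ℝ≥0 → ℝ≥0) : Prop where
  continuous : Continuous γ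
  strictMono : StrictMono γ
  zero : γ 0 = 0

/-- Class `𝒦ℒ` functions. -/
structure ClassKL (β : ℝ≥0 → ℝ≥0 → ℝ≥0) : Prop where
  classK : ∀ t, ClassK (fun s => β s t)
  antitone : ∀ s, Antitone (β s)
  tendsto : ∀ s, Tendsto (β s) atTop (𝓝 0)

/-- The system `x_{t+1} = f(x_t, d_t)` is LISS with parameters `ρx` and `ρ`. The norm on the
states is the Euclidean one, the norm on the inputs `ι → ℝ` is the maximum norm. -/
def IsLISS {n : ℕ} {ι : Type*} [Fintype ι] (f : Vec n → (ι → ℝ) → Vec n) (ρx ρ : ℝ) : Prop :=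
  Continuous (fun q : Vec n × (ι → ℝ) => f q.1 q.2) ∧ f 0 0 = 0 ∧ 0 < ρx ∧ 0 < ρ ∧
  ∃ (γ : ℝ≥0 → ℝ≥0) (β : ℝ≥0 → ℝ≥0 → ℝ≥0), ClassK γ ∧ ClassKL β ∧
    ∀ (x₀ : Vec n) (d : ℕ → ι → ℝ), ‖x₀‖ ≤ ρx → (∀ t, ‖d t‖ ≤ ρ) →
      ∀ t : ℕ, ‖trajectory f x₀ d t‖₊ ≤ β ‖x₀‖₊ (t : ℝ≥0) + γ (⨆ j, ‖d j‖₊)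

/-- The closed-loop dynamics `(x, (w, η)) ↦ θ φ(x, π(x) + η) + w`, where the pair `(w, η)` is
seen as one vector with `nx + nu` coordinates. -/
def closedLoop {nx nu m : ℕ} (θ : Matrix (Fin nx) (Fin m) ℝ) (φ : Fin m → Vec nx × Vec nu → ℝ)
    (π : Vec nx → Vec nu) (x : Vec nx) (d : Fin nx ⊕ Fin nu → ℝ) : Vec nx :=
  matVec θ (featureVec φ x (π x + WithLp.toLp 2 (fun j => d (Sum.inr j)))) +
    WithLp.toLp 2 (fun i => d (Sum.inl i))

/-! ### The block martingale small-ball condition -/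

/-- The σ-algebra generated by
`w_0, …, w_{t-1}, x_0, …, x_t, π(x_0), …, π(x_t), η_0, …, η_t`. -/
@[reducible] def dataSigma {Ω : Type*} {nx nu : ℕ} (w x : ℕ → Ω → Vec nx) (π : Vec nx → Vec nu)
    (η : ℕ → Ω → Vec nu) (t : ℕ) : MeasurableSpace Ω :=
  (⨆ i : Fin t, MeasurableSpace.comap (w i) inferInstance) ⊔
  (⨆ i : Fin (t + 1), MeasurableSpace.comap (x i) inferInstance) ⊔
  (⨆ i : Fin (t + 1), MeasurableSpace.comap (fun ω => π (x i ω)) inferInstance) ⊔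
  (⨆ i : Fin (t + 1), MeasurableSpace.comap (η i) inferInstance)

/-- `(ℱ t)_{t ≥ 1}` is a filtration, `(y t)_{t ≥ 1}` is adapted to it, and satisfies the
`(k, Γ, p)`-block martingale small-ball condition. -/
structure IsBMSB {Ω : Type*} [m₀ : MeasurableSpace Ω] (μ : Measure Ω) {n : ℕ}
    (ℱ : ℕ → MeasurableSpace Ω) (y : ℕ → Ω → Vec n) (k : ℕ) (Γ : Matrix (Fin n) (Fin n) ℝ)
    (p : ℝ) : Prop where
  filtration_le : ∀ t, 1 ≤ t → ℱ t ≤ m₀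
  filtration_mono : ∀ s t, 1 ≤ s → s ≤ t → ℱ s ≤ ℱ t
  adapted : ∀ t, 1 ≤ t → Measurable[ℱ t] (y t)
  k_pos : 0 < k
  posDef : Γ.PosDef
  p_mem : p ∈ Set.Icc (0 : ℝ) 1
  small_ball : ∀ v : Vec n, ‖v‖ = 1 → ∀ t, 1 ≤ t → ∀ᵐ ω ∂μ,
    p ≤ (1 / (k : ℝ)) * ∑ i ∈ Finset.Icc 1 k,
      (μ⟦{ω' | √(v.ofLp ⬝ᵥ (Γ *ᵥ v.ofLp)) ≤ |inner ℝ v (y (t + i) ω')|} | ℱ t⟧) ω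

/-! ### Least squares -/

/-- `θ'` minimises `∑_{t<T} ‖x_{t+1} - θ' y_t‖₂²`. -/
def IsLeastSquares {n m : ℕ} (T : ℕ) (x : ℕ → Vec n) (y : ℕ → Vec m)
    (θ' : Matrix (Fin n) (Fin m) ℝ) : Prop :=
  ∀ θ'' : Matrix (Fin n) (Fin m) ℝ,
    ∑ t ∈ Finset.range T, ‖x (t + 1) - matVec θ' (y t)‖ ^ 2 ≤
      ∑ t ∈ Finset.range T, ‖x (t + 1) - matVec θ'' (y t)‖ ^ 2

/-- The non-asymptotic error bound of least squares, with small-ball constants `s`, `p`, second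
moment bound `b` and noise level `σ`: for all `δ ∈ (0, 1)` and all `T ≥ 1` above the burn-in
time, with probability at least `1 - 3δ` every least squares estimate `θ'` from the first `T`
transitions satisfies the bound. The matrix norm is the largest singular value. -/
def LSERate {Ω : Type*} [MeasurableSpace Ω] (μ : Measure Ω) {n m : ℕ}
    (θ : Matrix (Fin n) (Fin m) ℝ) (x : ℕ → Ω → Vec n) (y : ℕ → Ω → Vec m)
    (s p b σ : ℝ) : Prop :=
  ∀ (δ : ℝ) (T : ℕ), 0 < δ → δ < 1 → 1 ≤ T →
    10 / p * (Real.log (1 / δ) + 2 * m * Real.log (10 / p) + m * Real.log (b / (δ * s ^ 2)))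
      ≤ (T : ℝ) →
    ∃ A : Set Ω, MeasurableSet A ∧ 1 - 3 * δ ≤ μ.real A ∧
      ∀ ω ∈ A, ∀ θ' : Matrix (Fin n) (Fin m) ℝ,
        IsLeastSquares T (fun t => x t ω) (fun t => y t ω) θ' →
        ‖θ' - θ‖ ≤ 90 * σ / p *
          √((n + Real.log (1 / δ) + m * Real.log (10 / p) + m * Real.log (b / (δ * s ^ 2)))
            / (T * s ^ 2))

/-! Boundedness. Almost every noise path is an admissible input for LISS and the initial state is
zero, so the states stay almost surely in a fixed ball; by continuity on compact sets the features
are almost surely bounded.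

Small ball (`exists_isBMSB`). Given `ℱ_t`, the vector `z = θ φ(x_t, u_t)` is known, and the next
feature vector is a function of `z` and of the fresh pair `(w_t, η_{t+1})`, which is independent of
`ℱ_t`. For a unit vector `v`, the function `vᵀφ(z + w, π(z + w) + η)` is analytic in `(w, η)` and
not identically zero, so its zero set is Lebesgue-null and cannot carry the product of two
semi-continuous laws. Compactness in `(v, z)` makes the resulting bound uniform.

Least squares (`lseRate_of_isBMSB`). Write `d = (θ' - θ)ᵀu` for a unit vector `u`. Comparing `θ'`
with a rank-one perturbation gives `∑ ⟪d, y_t⟫² ≤ 2 ∑ ⟪u, w_t⟫ ⟪d, y_t⟫`. If `V v = (⟪v, y_t⟫)_t`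
satisfies `a ‖v‖ ≤ ‖V v‖`, and the noise form is at most `K ‖u‖ ‖V v‖`, then `‖d‖ ≤ 2K / a`. The
excitation `a` comes from the small-ball condition through exponential moments
(`measureReal_sum_sq_lt_le`), and `K` from the exponential supermartingale of the noise
(`measureReal_transform_ge_le`). Both are controlled at the points of finite nets, whose mesh is
dictated by a Markov bound on `∑ ‖y_t‖²`. Each of these three controls fails with probability at
most `δ`.

Noise level. `σ_w` bounds the covariance from below and need not be a sub-Gaussian constant.
Hoeffding's lemma provides some constant `σ`. Outside the logarithms the rate sees only `σ / s`, and
the logarithms grow as `s` decreases; since decreasing `s` preserves the small-ball condition, it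
trades `σ` for `σ_w` (`LSERate.mono`). -/

/-! ### Zero sets of real-analytic functions -/

/-- The zero set of a real-analytic function on a finite-dimensional space which is not
identically zero is a null set. -/
theorem AnalyticOnNhd.addHaar_zeroSet {E : Type*} [NormedAddCommGroup E] [NormedSpace ℝ E]
    [FiniteDimensional ℝ E] [MeasurableSpace E] [BorelSpace E] (μ : Measure E)
    [μ.IsAddHaarMeasure] {f : E → ℝ} (hf : AnalyticOnNhd ℝ f Set.univ) {a : E} (ha : f a ≠ 0) :
    μ {x | f x = 0} = 0 := by
  have hcont : Continuous f := continuousOn_univ.1 hf.continuousOn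
  -- On each line through `a` the restriction is analytic and nonzero at `t = 0`, so its zeros form
  -- a discrete, hence countable, set of parameters.
  have hray : ∀ x : E, ∀ᵐ t : ℝ, f (a + t • x) ≠ 0 := by
    intro x
    have hg : AnalyticOnNhd ℝ (fun t : ℝ => f (a + t • x)) Set.univ := by
      intro t _
      have h1 : AnalyticAt ℝ (fun t : ℝ => a + t • x) t := by fun_prop
      exact (hf (a + t • x) (Set.mem_univ _)).comp_of_eq h1 rfl
    have h0 : (fun t : ℝ => f (a + t • x)) 0 ≠ 0 := by simpa using ha
    have hcod := hg.preimage_zero_mem_codiscrete h0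
    rw [ae_iff]
    refine Set.Countable.measure_zero ?_ _
    have hdisc := (mem_codiscrete'.1 hcod).2
    have hc : (fun t : ℝ => f (a + t • x)) ⁻¹' {0}ᶜ = {t | f (a + t • x) ≠ 0} := by
      ext; simp
    rw [hc] at hdisc
    have hcompl : {t : ℝ | ¬ f (a + t • x) ≠ 0} = {t | f (a + t • x) ≠ 0}ᶜ := rfl
    rw [hcompl]
    have : DiscreteTopology ({t | f (a + t • x) ≠ 0}ᶜ : Set ℝ) := by
      exact hdisc.to_subtype
    exact Set.countable_coe_iff.1 (TopologicalSpace.separableSpace_iff_countable.1 inferInstance)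
  -- By Fubini some single `t ≠ 0` works for almost every `x`; the map `x ↦ a + t • x` only rescales
  -- Haar measure, so nullity passes back to the zero set.
  have hswap : ∀ᵐ t : ℝ, ∀ᵐ x ∂μ, f (a + t • x) ≠ 0 := by
    rw [← Measure.ae_ae_comm (μ := μ) (ν := volume)]
    · exact Eventually.of_forall hray
    · exact (IsOpen.measurableSet (isOpen_ne_fun (by fun_prop) (by fun_prop)))
  have h1 : ∃ t : ℝ, t ≠ 0 ∧ ∀ᵐ x ∂μ, f (a + t • x) ≠ 0 := by
    have h0 : ∀ᵐ t : ℝ, t ≠ 0 := by simp [ae_iff]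
    exact (h0.and hswap).exists
  obtain ⟨t, ht, hae⟩ := h1
  rw [ae_iff] at hae
  have hset : {x | ¬ f (a + t • x) ≠ 0} = (t • ·) ⁻¹' ((a + ·) ⁻¹' {x | f x = 0}) := by
    ext; simp
  rw [hset, Measure.addHaar_preimage_smul μ ht, measure_preimage_add] at hae
  rcases mul_eq_zero.1 hae with h | h
  · simp [ht] at h
  · exact h

/-! ### Nets in finite dimension -/

/-- A subset of the unit ball has a finite `ε`-net with at most `(3 / ε) ^ dim` points. -/
theorem exists_finset_net {E : Type*} [NormedAddCommGroup E] [NormedSpace ℝ E]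
    [FiniteDimensional ℝ E] {A : Set E} (hA : ∀ x ∈ A, ‖x‖ ≤ 1) {ε : ℝ} (hε : 0 < ε)
    (hε1 : ε ≤ 1) :
    ∃ N : Finset E, (∀ x ∈ N, x ∈ A) ∧ (∀ x ∈ A, ∃ y ∈ N, ‖x - y‖ ≤ ε) ∧
      (N.card : ℝ) ≤ (3 / ε) ^ Module.finrank ℝ E := by
  borelize E
  let μ : Measure E := Measure.addHaar
  -- Volume comparison: for an `ε`-separated set the balls of radius `ε / 2` are disjoint and lie in
  -- the ball of radius `1 + ε / 2 ≤ 3 / 2`.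
  have hsep : ∀ s : Finset E, (∀ x ∈ s, x ∈ A) → (∀ x ∈ s, ∀ y ∈ s, x ≠ y → ε < ‖x - y‖) →
      (s.card : ℝ) ≤ (3 / ε) ^ Module.finrank ℝ E := by
    intro s hs h
    have D : Set.Pairwise (s : Set E)
        (Function.onFun Disjoint fun c => Metric.ball (c : E) (ε / 2)) := by
      rintro c hc d hd hcd
      apply Metric.ball_disjoint_ball
      rw [dist_eq_norm]
      linarith [h c hc d hd hcd]
    have hsub : ⋃ c ∈ s, Metric.ball (c : E) (ε / 2) ⊆ Metric.ball (0 : E) (3 / 2) := by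
      refine Set.iUnion₂_subset fun x hx => Metric.ball_subset_ball' ?_
      rw [dist_zero_right]
      linarith [hA x (hs x hx)]
    have I : (s.card : ℝ≥0∞) * ENNReal.ofReal ((ε / 2) ^ Module.finrank ℝ E) *
        μ (Metric.ball 0 1) ≤
        ENNReal.ofReal ((3 / 2) ^ Module.finrank ℝ E) * μ (Metric.ball 0 1) := by
      have e := measure_mono (μ := μ) hsub
      rw [measure_biUnion_finset D fun c _ => measurableSet_ball] at e
      simp only [μ.addHaar_ball_of_pos _ (half_pos hε)] at e
      rw [μ.addHaar_ball_of_pos _ (by norm_num : (0 : ℝ) < 3 / 2)] at e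
      simpa only [Finset.sum_const, nsmul_eq_mul, mul_assoc] using e
    have J := (ENNReal.mul_le_mul_iff_left (Metric.measure_ball_pos _ _ zero_lt_one).ne'
      measure_ball_lt_top.ne).1 I
    have K := ENNReal.toReal_le_of_le_ofReal (by positivity) J
    rw [ENNReal.toReal_mul, ENNReal.toReal_natCast, ENNReal.toReal_ofReal (by positivity)] at K
    have : (3 / ε) ^ Module.finrank ℝ E =
        (3 / 2) ^ Module.finrank ℝ E / (ε / 2) ^ Module.finrank ℝ E := by
      rw [← div_pow]
      congr 1
      field_simp
    rw [this, le_div_iff₀ (by positivity)]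
    exact K
  -- The cardinality bound yields a separated set of maximal size. It is a net, since an uncovered
  -- point could be added to it.
  obtain ⟨k, hk⟩ := exists_nat_ge ((3 / ε) ^ Module.finrank ℝ E)
  let P : ℕ → Prop := fun j => ∃ s : Finset E, s.card = j ∧ (∀ x ∈ s, x ∈ A) ∧
    ∀ x ∈ s, ∀ y ∈ s, x ≠ y → ε < ‖x - y‖
  classical
  have hP : P (Nat.findGreatest P k) :=
    Nat.findGreatest_spec (m := 0) (Nat.zero_le _) ⟨∅, by simp⟩
  obtain ⟨s, hcard, hsA, hs⟩ := hP
  refine ⟨s, hsA, ?_, hsep s hsA hs⟩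
  by_contra! hcon
  obtain ⟨x, hx, hxs⟩ := hcon
  have hxs' : x ∉ s := fun hmem => by
    have := hxs x hmem
    simp at this
    linarith
  have hP' : P (s.card + 1) := by
    refine ⟨insert x s, Finset.card_insert_of_notMem hxs', ?_, ?_⟩
    · intro z hz
      rcases Finset.mem_insert.1 hz with rfl | hz
      · exact hx
      · exact hsA z hz
    · intro z hz z' hz' hne
      rcases Finset.mem_insert.1 hz with rfl | hz <;> rcases Finset.mem_insert.1 hz' with rfl | hz'
      · exact absurd rfl hne
      · exact hxs z' hz'
      · rw [norm_sub_rev]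
        exact hxs z (by assumption)
      · exact hs z hz z' hz' hne
  have hle : s.card + 1 ≤ k := by
    obtain ⟨s', hs'c, hs'A, hs'⟩ := hP'
    have := hsep s' hs'A hs'
    rw [hs'c] at this
    exact_mod_cast this.trans hk
  have := Nat.le_findGreatest hle hP'
  omega

/-! ### Regrouping independent pairs -/

/-- The σ-algebra of a pair is generated by the π-system of preimages of rectangles. -/
theorem comap_prodMk_eq_generateFrom {Ω α β : Type*} [MeasurableSpace α] [MeasurableSpace β]
    (X : Ω → α) (Y : Ω → β) :
    MeasurableSpace.comap (fun ω => (X ω, Y ω)) inferInstance =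
      MeasurableSpace.generateFrom (Set.preimage (fun ω => (X ω, Y ω)) ''
        Set.image2 (· ×ˢ ·) {s : Set α | MeasurableSet s} {t : Set β | MeasurableSet t}) := by
  rw [← MeasurableSpace.comap_generateFrom, generateFrom_prod]

theorem isPiSystem_preimage_prodMk {Ω α β : Type*} [MeasurableSpace α] [MeasurableSpace β]
    (X : Ω → α) (Y : Ω → β) :
    IsPiSystem (Set.preimage (fun ω => (X ω, Y ω)) ''
      Set.image2 (· ×ˢ ·) {s : Set α | MeasurableSet s} {t : Set β | MeasurableSet t}) := by
  convert! (isPiSystem_prod (α := α) (β := β)).comap (fun ω => (X ω, Y ω)) using 1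

/-- Two independent pairs with independent components can be regrouped. -/
theorem ProbabilityTheory.IndepFun.prodMk_prodMk_swap {Ω α₁ α₂ β₁ β₂ : Type*} [MeasurableSpace Ω]
    [MeasurableSpace α₁] [MeasurableSpace α₂] [MeasurableSpace β₁] [MeasurableSpace β₂]
    {μ : Measure Ω} [IsProbabilityMeasure μ] {X₁ : Ω → α₁} {X₂ : Ω → α₂} {Y₁ : Ω → β₁}
    {Y₂ : Ω → β₂} (hX₁ : Measurable X₁) (hX₂ : Measurable X₂) (hY₁ : Measurable Y₁)
    (hY₂ : Measurable Y₂) (hX : IndepFun X₁ X₂ μ) (hY : IndepFun Y₁ Y₂ μ)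
    (hXY : IndepFun (fun ω => (X₁ ω, X₂ ω)) (fun ω => (Y₁ ω, Y₂ ω)) μ) :
    IndepFun (fun ω => (X₁ ω, Y₁ ω)) (fun ω => (X₂ ω, Y₂ ω)) μ := by
  rw [IndepFun_iff_Indep]
  refine IndepSets.indep (hX₁.prodMk hY₁).comap_le (hX₂.prodMk hY₂).comap_le
    (isPiSystem_preimage_prodMk X₁ Y₁)
    (isPiSystem_preimage_prodMk X₂ Y₂)
    (comap_prodMk_eq_generateFrom X₁ Y₁) (comap_prodMk_eq_generateFrom X₂ Y₂) ?_
  rw [IndepSets_iff]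
  rintro _ _ ⟨_, ⟨s₁, hs₁, t₁, ht₁, rfl⟩, rfl⟩ ⟨_, ⟨s₂, hs₂, t₂, ht₂, rfl⟩, rfl⟩
  -- On rectangles the joint probability splits into four factors; `e2` and `e3` reassemble them
  -- into the two new pairs.
  have e1 := hXY.measure_inter_preimage_eq_mul _ _ (hs₁.prod hs₂) (ht₁.prod ht₂)
  have e2 := hXY.measure_inter_preimage_eq_mul _ _ (hs₁.prod .univ) (ht₁.prod .univ)
  have e3 := hXY.measure_inter_preimage_eq_mul _ _ (MeasurableSet.univ.prod hs₂)
    (MeasurableSet.univ.prod ht₂)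
  have eX := hX.measure_inter_preimage_eq_mul _ _ hs₁ hs₂
  have eY := hY.measure_inter_preimage_eq_mul _ _ ht₁ ht₂
  simp only [Set.mk_preimage_prod, Set.preimage_univ, Set.inter_univ, Set.univ_inter] at e1 e2 e3 ⊢
  rw [Set.inter_inter_inter_comm, e1, eX, eY, e2, e3]
  ring

/-! ### Deterministic least squares bound -/

/-- A self-normalised bilinear bound from its values on nets: `⟪U u, V v⟫ ≤ K ‖u‖ ‖V v‖`, where
`K` is controlled by bounds on `⟪U u', V v'⟫` for `u'` and `v'` in finite nets. -/
theorem exists_inner_le_of_nets {E F G : Type*} [NormedAddCommGroup E] [NormedSpace ℝ E]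
    [FiniteDimensional ℝ E] [Nontrivial E] [NormedAddCommGroup F] [NormedSpace ℝ F]
    [FiniteDimensional ℝ F]
    [NormedAddCommGroup G] [InnerProductSpace ℝ G] (U : E →L[ℝ] G) (V : F →L[ℝ] G)
    {a ε r c Q : ℝ} (ha : 0 < a) (hr : 0 < r) (hc : 0 ≤ c)
    (hlow : ∀ v, a * ‖v‖ ≤ ‖V v‖) (hup : ∀ v, ‖v‖ ≤ ε → ‖V v‖ ≤ a / 4)
    {Nu : Finset E} {Nv : Finset F} (hNu1 : ∀ u ∈ Nu, ‖u‖ = 1)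
    (hNu : ∀ u, ‖u‖ = 1 → ∃ u' ∈ Nu, ‖u - u'‖ ≤ 1 / 4)
    (hNv : ∀ v, ‖v‖ ≤ 1 → ∃ v' ∈ Nv, ‖v - v'‖ ≤ ε)
    (hbd : ∀ u ∈ Nu, ∀ v ∈ Nv,
      inner ℝ (U u) (V ((r / a) • v)) ≤ c / 2 * ‖V ((r / a) • v)‖ ^ 2 + Q) :
    ∃ K, 0 ≤ K ∧ K * r ≤ 2 * (25 / 32 * c * r ^ 2 + Q) ∧
      ∀ u v, inner ℝ (U u) (V v) ≤ K * ‖u‖ * ‖V v‖ := by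
  have := FiniteDimensional.proper ℝ E
  have := FiniteDimensional.proper ℝ F
  -- The lower bound on `V` makes its unit sublevel set bounded, so the best constant `K` is
  -- attained at some `(u₀, v₀)`.
  have hcomp : IsCompact ((Metric.sphere (0 : E) 1) ×ˢ {v : F | ‖V v‖ ≤ 1}) := by
    refine (isCompact_sphere 0 1).prod (Metric.isCompact_of_isClosed_isBounded ?_ ?_)
    · exact isClosed_le (by fun_prop) (by fun_prop)
    · refine (Metric.isBounded_closedBall (x := (0 : F)) (r := 1 / a)).subset fun v hv => ?_
      rw [mem_closedBall_zero_iff, le_div_iff₀ ha, mul_comm]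
      exact (hlow v).trans hv
  obtain ⟨e, he⟩ := exists_norm_eq E zero_le_one
  obtain ⟨⟨u₀, v₀⟩, ⟨hu₀, hv₀⟩, hmax⟩ := hcomp.exists_isMaxOn
    (f := fun q : E × F => (inner ℝ (U q.1) (V q.2) : ℝ)) ⟨(e, 0), by simp [he]⟩
    (by fun_prop)
  simp only [mem_sphere_iff_norm, sub_zero] at hu₀
  simp only [Set.mem_ofPred_eq] at hv₀
  set K : ℝ := inner ℝ (U u₀) (V v₀) with hK
  have hmax' : ∀ u v, ‖u‖ = 1 → ‖V v‖ ≤ 1 → inner ℝ (U u) (V v) ≤ K := fun u v hu hv =>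
    hmax (show (u, v) ∈ _ from ⟨by simpa using hu, hv⟩)
  have hK0 : 0 ≤ K := by simpa using hmax' e 0 he (by simp)
  have hgen : ∀ u v, inner ℝ (U u) (V v) ≤ K * ‖u‖ * ‖V v‖ := by
    intro u v
    rcases eq_or_ne u 0 with rfl | hu
    · simp
    rcases eq_or_ne (V v) 0 with hv | hv
    · simp [hv]
    have hu' := norm_pos_iff.2 hu
    have hv' := norm_pos_iff.2 hv
    have h := hmax' (‖u‖⁻¹ • u) (‖V v‖⁻¹ • v) (by
      rw [norm_smul, norm_inv, norm_norm, inv_mul_cancel₀ hu'.ne'])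
      (by rw [map_smul, norm_smul, norm_inv, norm_norm, inv_mul_cancel₀ hv'.ne'])
    rw [map_smul, map_smul, real_inner_smul_left, real_inner_smul_right] at h
    have : inner ℝ (U u) (V v) =
        (‖u‖⁻¹ * (‖V v‖⁻¹ * inner ℝ (U u) (V v))) * ‖u‖ * ‖V v‖ := by
      field_simp
    rw [this]
    gcongr
  refine ⟨K, hK0, ?_, hgen⟩
  obtain ⟨u', hu', hu₀'⟩ := hNu u₀ hu₀
  -- Only `a • v₀` is known to lie in the unit ball covered by the net; `v₀` itself may be long.
  obtain ⟨v', hv', hv₀'⟩ := hNv (a • v₀) (by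
    rw [norm_smul, Real.norm_of_nonneg ha.le]
    exact (hlow v₀).trans hv₀)
  have hdiff : ‖V (v₀ - a⁻¹ • v')‖ ≤ 1 / 4 := by
    have h1 : v₀ - a⁻¹ • v' = a⁻¹ • (a • v₀ - v') := by
      rw [smul_sub, smul_smul, inv_mul_cancel₀ ha.ne', one_smul]
    rw [h1, map_smul, norm_smul, norm_inv, Real.norm_of_nonneg ha.le, inv_mul_le_iff₀ ha]
    linarith [hup _ hv₀']
  have hV' : ‖V (a⁻¹ • v')‖ ≤ 5 / 4 := by
    have : V (a⁻¹ • v') = V v₀ - V (v₀ - a⁻¹ • v') := by rw [map_sub]; abel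
    rw [this]
    exact (norm_sub_le _ _).trans (by linarith)
  have hb := hbd u' hu' v' hv'
  have hra : (r / a) • v' = r • (a⁻¹ • v') := by rw [smul_smul, div_eq_mul_inv]
  rw [hra, map_smul, real_inner_smul_right, norm_smul, Real.norm_of_nonneg hr.le] at hb
  -- Each of the two approximation errors is at most `K / 4` by maximality of `K`, so `K` is at most
  -- twice the value at the net points.
  have hsplit : K = inner ℝ (U u') (V (a⁻¹ • v')) + inner ℝ (U (u₀ - u')) (V v₀)
      + inner ℝ (U u') (V (v₀ - a⁻¹ • v')) := by
    simp only [hK, map_sub, inner_sub_left, inner_sub_right]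
    ring
  have h1 : inner ℝ (U (u₀ - u')) (V v₀) ≤ K / 4 := by
    refine (hgen _ _).trans ?_
    have := mul_le_mul hu₀' hv₀ (norm_nonneg _) (by norm_num)
    nlinarith
  have h2 : inner ℝ (U u') (V (v₀ - a⁻¹ • v')) ≤ K / 4 := by
    refine (hgen _ _).trans ?_
    rw [hNu1 u' hu']
    nlinarith
  -- Source of the constant: `25 / 32 = (5 / 4)² / 2`.
  have h3 : c / 2 * (r * ‖V (a⁻¹ • v')‖) ^ 2 ≤ c / 2 * (r * (5 / 4)) ^ 2 := by gcongr
  nlinarith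

/-- The vector `(⟪v, y_t⟫)_{t<T}` as a linear function of `v`. -/
noncomputable def innerSeq {m : ℕ} (y : ℕ → Vec m) (T : ℕ) :
    Vec m →L[ℝ] EuclideanSpace ℝ (Fin T) :=
  LinearMap.toContinuousLinearMap
    { toFun := fun v => WithLp.toLp 2 (fun t : Fin T => inner ℝ v (y t))
      map_add' := fun v v' => by ext t; simp [inner_add_left]
      map_smul' := fun r v => by ext t; simp [real_inner_smul_left] }

theorem innerSeq_inner {n m : ℕ} (w : ℕ → Vec n) (y : ℕ → Vec m) (T : ℕ) (u : Vec n) (v : Vec m) :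
    inner ℝ (innerSeq w T u) (innerSeq y T v) =
      ∑ t ∈ Finset.range T, inner ℝ u (w t) * inner ℝ v (y t) := by
  rw [Finset.sum_range]
  simp [innerSeq, PiLp.inner_apply, mul_comm]

theorem norm_innerSeq_sq {m : ℕ} (y : ℕ → Vec m) (T : ℕ) (v : Vec m) :
    ‖innerSeq y T v‖ ^ 2 = ∑ t ∈ Finset.range T, (inner ℝ v (y t) : ℝ) ^ 2 := by
  rw [← real_inner_self_eq_norm_sq, innerSeq_inner]
  simp only [sq]

theorem matVec_sub {n m : ℕ} (A B : Matrix (Fin n) (Fin m) ℝ) (y : Vec m) :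
    matVec (A - B) y = matVec A y - matVec B y := by
  simp [matVec, Matrix.sub_mulVec]

theorem inner_matVec {n m : ℕ} (A : Matrix (Fin n) (Fin m) ℝ) (u : Vec n) (y : Vec m) :
    inner ℝ u (matVec A y) = inner ℝ (matVec Aᵀ u) y := by
  simp [matVec, EuclideanSpace.inner_eq_star_dotProduct, Matrix.dotProduct_mulVec,
    Matrix.mulVec_transpose, dotProduct_comm]

theorem matVec_vecMulVec {n m : ℕ} (u : Vec n) (d y : Vec m) :
    matVec (Matrix.vecMulVec u.ofLp d.ofLp) y = (inner ℝ d y : ℝ) • u := by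
  ext i
  simp [matVec, Matrix.mulVec, dotProduct, Matrix.vecMulVec_apply, PiLp.inner_apply,
    Finset.sum_mul]
  exact Finset.sum_congr rfl fun j _ => by ring

/-- The basic inequality of least squares, in direction `u`. -/
theorem IsLeastSquares.sum_sq_le {n m T : ℕ} {x w : ℕ → Vec n} {y : ℕ → Vec m}
    {θ θ' : Matrix (Fin n) (Fin m) ℝ} (hx : ∀ t, x (t + 1) = matVec θ (y t) + w t)
    (h : IsLeastSquares T x y θ') {u : Vec n} (hu : ‖u‖ = 1) :
    ∑ t ∈ Finset.range T, (inner ℝ (matVec (θ' - θ)ᵀ u) (y t) : ℝ) ^ 2 ≤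
      2 * ∑ t ∈ Finset.range T, inner ℝ u (w t) * inner ℝ (matVec (θ' - θ)ᵀ u) (y t) := by
  set d := matVec (θ' - θ)ᵀ u with hd
  -- The competitor `θ' - u dᵀ` removes the whole error of `θ'` in direction `u`, because `uᵀ(θ' -
  -- θ) = dᵀ` and `‖u‖ = 1`.
  have h1 := h (θ' - Matrix.vecMulVec u.ofLp d.ofLp)
  have h2 : ∀ t, ‖x (t + 1) - matVec (θ' - Matrix.vecMulVec u.ofLp d.ofLp) (y t)‖ ^ 2 =
      ‖x (t + 1) - matVec θ' (y t)‖ ^ 2 + 2 * (inner ℝ u (w t) * inner ℝ d (y t))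
        - (inner ℝ d (y t)) ^ 2 := by
    intro t
    have e1 : x (t + 1) - matVec (θ' - Matrix.vecMulVec u.ofLp d.ofLp) (y t) =
        (x (t + 1) - matVec θ' (y t)) + (inner ℝ d (y t) : ℝ) • u := by
      rw [matVec_sub, matVec_vecMulVec]; abel
    have e2 : inner ℝ (x (t + 1) - matVec θ' (y t)) u = inner ℝ u (w t) - inner ℝ d (y t) := by
      have : x (t + 1) - matVec θ' (y t) = w t - matVec (θ' - θ) (y t) := by
        rw [hx, matVec_sub]; abel
      rw [this, real_inner_comm, inner_sub_right, inner_matVec]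
    rw [e1, norm_add_sq_real, real_inner_smul_right, e2, norm_smul, hu, mul_one, Real.norm_eq_abs,
      sq_abs]
    ring
  simp only [h2, Finset.sum_sub_distrib, Finset.sum_add_distrib, ← Finset.mul_sum] at h1
  linarith

theorem norm_le_of_matVec_transpose_le {n m : ℕ} (D : Matrix (Fin n) (Fin m) ℝ) {R : ℝ}
    (hR : 0 ≤ R) (h : ∀ u : Vec n, ‖u‖ = 1 → ‖matVec Dᵀ u‖ ≤ R) : ‖D‖ ≤ R := by
  rw [← Matrix.l2_opNorm_conjTranspose, Matrix.conjTranspose_eq_transpose_of_trivial,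
    Matrix.l2_opNorm_def]
  refine ContinuousLinearMap.opNorm_le_of_unit_norm hR fun u hu => h u hu

/-- Deterministic error bound for least squares, given excitation of the regressors and control
of the noise on finite nets. -/
theorem IsLeastSquares.norm_sub_le {n m T : ℕ} [NeZero n] {x w : ℕ → Vec n} {y : ℕ → Vec m}
    {θ θ' : Matrix (Fin n) (Fin m) ℝ} (hx : ∀ t, x (t + 1) = matVec θ (y t) + w t)
    (h : IsLeastSquares T x y θ') {a ε r c Q : ℝ} (ha : 0 < a) (hr : 0 < r) (hc : 0 ≤ c)
    (hlow : ∀ v, a * ‖v‖ ≤ ‖innerSeq y T v‖) (hup : ∀ v, ‖v‖ ≤ ε → ‖innerSeq y T v‖ ≤ a / 4)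
    {Nu : Finset (Vec n)} {Nv : Finset (Vec m)} (hNu1 : ∀ u ∈ Nu, ‖u‖ = 1)
    (hNu : ∀ u, ‖u‖ = 1 → ∃ u' ∈ Nu, ‖u - u'‖ ≤ 1 / 4)
    (hNv : ∀ v, ‖v‖ ≤ 1 → ∃ v' ∈ Nv, ‖v - v'‖ ≤ ε)
    (hbd : ∀ u ∈ Nu, ∀ v ∈ Nv,
      ∑ t ∈ Finset.range T, inner ℝ u (w t) * inner ℝ ((r / a) • v) (y t) ≤
        c / 2 * ∑ t ∈ Finset.range T, (inner ℝ ((r / a) • v) (y t) : ℝ) ^ 2 + Q) :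
    ‖θ' - θ‖ ≤ 4 * (25 / 32 * c * r ^ 2 + Q) / (a * r) := by
  obtain ⟨K, hK0, hKr, hK⟩ := exists_inner_le_of_nets (innerSeq w T) (innerSeq y T) ha hr hc
    hlow hup hNu1 hNu hNv (Q := Q) (fun u hu v hv => by
      rw [innerSeq_inner, norm_innerSeq_sq]
      exact hbd u hu v hv)
  have hle : 2 * K / a ≤ 4 * (25 / 32 * c * r ^ 2 + Q) / (a * r) := by
    rw [div_le_div_iff₀ ha (by positivity)]
    nlinarith
  refine le_trans (norm_le_of_matVec_transpose_le _ (by positivity) fun u hu => ?_) hle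
  have h1 := h.sum_sq_le hx hu
  set d := matVec (θ' - θ)ᵀ u
  rw [← norm_innerSeq_sq, ← innerSeq_inner] at h1
  have h2 := hK u d
  rw [hu, mul_one] at h2
  -- The quadratic form of `d` is at most `2 K ‖V d‖`; one factor `‖V d‖` cancels.
  have h3 : ‖innerSeq y T d‖ ≤ 2 * K := by
    by_contra! hlt
    nlinarith
  rw [le_div_iff₀ ha, mul_comm]
  exact (hlow d).trans h3

/-! ### Martingale concentration -/

/-- If `Z` is measurable with respect to `m` and the conditional probability of `B` given `m` is
at least `p`, then multiplying `Z` by `1 - r` on `B` reduces its integral by a factor `1 - p r`. -/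
theorem integral_mul_one_sub_indicator_le {Ω : Type*} {m m₀ : MeasurableSpace Ω} {μ : Measure Ω}
    [IsProbabilityMeasure μ] (hm : m ≤ m₀) {Z : Ω → ℝ} (hZ : Measurable[m] Z)
    (hZ0 : ∀ ω, 0 ≤ Z ω) (hZ1 : ∀ ω, Z ω ≤ 1) {B : Set Ω} (hB : MeasurableSet[m₀] B) {p r : ℝ}
    (hr : 0 ≤ r) (hp : ∀ᵐ ω ∂μ, p ≤ (μ⟦B | m⟧) ω) :
    ∫ ω, Z ω * (1 - r * B.indicator (fun _ => (1 : ℝ)) ω) ∂μ ≤ (1 - p * r) * ∫ ω, Z ω ∂μ := by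
  have hZm : Measurable[m₀] Z := hZ.mono hm le_rfl
  have hZi : Integrable Z μ := Integrable.of_bound hZm.aestronglyMeasurable 1
    (Eventually.of_forall fun ω => by rw [Real.norm_of_nonneg (hZ0 ω)]; exact hZ1 ω)
  have hBi : Integrable (B.indicator (fun _ => (1 : ℝ))) μ := (integrable_const 1).indicator hB
  have hZBi : Integrable (Z * B.indicator (fun _ => (1 : ℝ))) μ := by
    refine Integrable.mono' hZi (hZi.1.mul hBi.1) (Eventually.of_forall fun ω => ?_)
    by_cases h : ω ∈ B <;> simp [h, abs_of_nonneg (hZ0 ω), hZ0 ω]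
  have hpull := condExp_mul_of_stronglyMeasurable_left (m := m) hZ.stronglyMeasurable hZBi hBi
  have hlow : p * ∫ ω, Z ω ∂μ ≤ ∫ ω, (Z * B.indicator (fun _ => (1 : ℝ))) ω ∂μ := by
    rw [← integral_condExp hm (f := Z * _), ← integral_const_mul]
    refine integral_mono_ae (hZi.const_mul p) integrable_condExp ?_
    filter_upwards [hpull, hp] with ω h1 h2
    rw [h1, Pi.mul_apply, mul_comm]
    exact mul_le_mul_of_nonneg_left h2 (hZ0 ω)
  have heq : ∫ ω, Z ω * (1 - r * B.indicator (fun _ => (1 : ℝ)) ω) ∂μ =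
      ∫ ω, Z ω ∂μ - r * ∫ ω, (Z * B.indicator (fun _ => (1 : ℝ))) ω ∂μ := by
    rw [← integral_const_mul, ← integral_sub hZi (hZBi.const_mul r)]
    congr 1 with ω
    simp only [Pi.mul_apply]
    ring
  rw [heq]
  nlinarith

/-- Exponential moments of the number of successes among events with conditional probability at
least `p`. -/
theorem integral_prod_one_sub_indicator_le {Ω : Type*} [m₀ : MeasurableSpace Ω] {μ : Measure Ω}
    [IsProbabilityMeasure μ] {ℱ : ℕ → MeasurableSpace Ω} (hle : ∀ t, 1 ≤ t → ℱ t ≤ m₀)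
    (hmono : ∀ s t, 1 ≤ s → s ≤ t → ℱ s ≤ ℱ t) {B : ℕ → Set Ω}
    (hB : ∀ t, 1 ≤ t → MeasurableSet[ℱ t] (B t)) {p r : ℝ} (hr : 0 ≤ r) (hr1 : r ≤ 1)
    (hp1 : p ≤ 1) (hp : ∀ t, 1 ≤ t → ∀ᵐ ω ∂μ, p ≤ (μ⟦B (t + 1) | ℱ t⟧) ω) (k : ℕ) :
    ∫ ω, ∏ j ∈ Finset.range k, (1 - r * (B (j + 2)).indicator (fun _ => (1 : ℝ)) ω) ∂μ ≤
      (1 - p * r) ^ k := by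
  have hfac0 : ∀ j ω, 0 ≤ 1 - r * (B (j + 2)).indicator (fun _ => (1 : ℝ)) ω := by
    intro j ω
    by_cases h : ω ∈ B (j + 2) <;> simp [h, hr1]
  have hfac1 : ∀ j ω, 1 - r * (B (j + 2)).indicator (fun _ => (1 : ℝ)) ω ≤ 1 := by
    intro j ω
    by_cases h : ω ∈ B (j + 2) <;> simp [h, hr]
  induction k with
  | zero => simp
  | succ k ih =>
    simp only [Finset.prod_range_succ]
    -- The first controlled event is `B 2`, since conditioning starts with `ℱ 1`. The last factor is
    -- conditioned on `ℱ (k + 1)`, for which all earlier factors are measurable.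
    have hmeas : Measurable[ℱ (k + 1)] fun ω =>
        ∏ j ∈ Finset.range k, (1 - r * (B (j + 2)).indicator (fun _ => (1 : ℝ)) ω) := by
      refine Finset.measurable_prod _ fun j hj => ?_
      have hBj : MeasurableSet[ℱ (k + 1)] (B (j + 2)) :=
        hmono _ _ (by omega) (by have := Finset.mem_range.1 hj; omega) _ (hB (j + 2) (by omega))
      exact measurable_const.sub ((measurable_const.indicator hBj).const_mul r)
    refine (integral_mul_one_sub_indicator_le (hle (k + 1) (by omega)) hmeas
      (fun ω => Finset.prod_nonneg fun j _ => hfac0 j ω)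
      (fun ω => Finset.prod_le_one (fun j _ => hfac0 j ω) fun j _ => hfac1 j ω)
      (hle (k + 2) (by omega) _ (hB (k + 2) (by omega))) hr (hp (k + 1) (by omega))).trans ?_
    rw [pow_succ, mul_comm]
    exact mul_le_mul_of_nonneg_right ih (by nlinarith)

/-- Lower tail bound for a sum of squares under a small-ball condition. -/
theorem measureReal_sum_sq_lt_le {Ω : Type*} [m₀ : MeasurableSpace Ω] {μ : Measure Ω}
    [IsProbabilityMeasure μ] {ℱ : ℕ → MeasurableSpace Ω} (hle : ∀ t, 1 ≤ t → ℱ t ≤ m₀)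
    (hmono : ∀ s t, 1 ≤ s → s ≤ t → ℱ s ≤ ℱ t) {Y : ℕ → Ω → ℝ}
    (hY : ∀ t, 1 ≤ t → Measurable[ℱ t] (Y t)) {p s : ℝ} (hs : 0 < s) (hp0 : 0 ≤ p) (hp1 : p ≤ 1)
    (hp : ∀ t, 1 ≤ t → ∀ᵐ ω ∂μ, p ≤ (μ⟦{ω' | s ≤ |Y (t + 1) ω'|} | ℱ t⟧) ω) {T : ℕ}
    (hT : 5 ≤ T) :
    μ.real {ω | ∑ t ∈ Finset.range T, Y t ω ^ 2 < s ^ 2 * (p * T) / 4} ≤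
      Real.exp (-(p * T / 10)) := by
  obtain ⟨k, rfl⟩ : ∃ k, T = k + 2 := ⟨T - 2, by omega⟩
  set B : ℕ → Set Ω := fun t => {ω | s ≤ |Y t ω|} with hBdef
  have hB : ∀ t, 1 ≤ t → MeasurableSet[ℱ t] (B t) := fun t ht =>
    hY t ht (measurableSet_le measurable_const measurable_id.abs : MeasurableSet {y : ℝ | s ≤ |y|})
  -- With `r = 1 - e⁻¹` each factor of the product equals `exp (-1_B)`, which dominates `exp (-Y² /
  -- s²)`.
  set q : ℝ := Real.exp (-1) with hq
  have hq0 : 0 < q := Real.exp_pos _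
  have hq4 : q ≤ 2 / 5 := by
    have h1 := Real.exp_one_gt_d9
    have h2 : Real.exp 1 * q = 1 := by rw [hq, ← Real.exp_add]; simp
    nlinarith
  have hint := integral_prod_one_sub_indicator_le hle hmono hB (r := 1 - q) (by linarith)
    (by linarith) hp1 hp k
  set Z : Ω → ℝ := fun ω =>
    ∏ j ∈ Finset.range k, (1 - (1 - q) * (B (j + 2)).indicator (fun _ => (1 : ℝ)) ω) with hZ
  have hfac0 : ∀ j ω, 0 ≤ 1 - (1 - q) * (B (j + 2)).indicator (fun _ => (1 : ℝ)) ω := by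
    intro j ω
    by_cases h : ω ∈ B (j + 2) <;> simp [h, hq0.le]
  have hfac1 : ∀ j ω, 1 - (1 - q) * (B (j + 2)).indicator (fun _ => (1 : ℝ)) ω ≤ 1 := by
    intro j ω
    by_cases h : ω ∈ B (j + 2) <;> simp [h]
    linarith
  have hZ0 : ∀ ω, 0 ≤ Z ω := fun ω => Finset.prod_nonneg fun j _ => hfac0 j ω
  have hZ1 : ∀ ω, Z ω ≤ 1 := fun ω =>
    Finset.prod_le_one (fun j _ => hfac0 j ω) fun j _ => hfac1 j ω
  have hZm : Measurable Z := by
    refine Finset.measurable_prod _ fun j _ => ?_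
    exact measurable_const.sub ((measurable_const.indicator
      (hle (j + 2) (by omega) _ (hB (j + 2) (by omega)))).const_mul _)
  have hZi : Integrable Z μ := Integrable.of_bound hZm.aestronglyMeasurable 1
    (Eventually.of_forall fun ω => by rw [Real.norm_of_nonneg (hZ0 ω)]; exact hZ1 ω)
  have hsub : {ω | ∑ t ∈ Finset.range (k + 2), Y t ω ^ 2 < s ^ 2 * (p * ((k + 2 : ℕ) : ℝ)) / 4} ⊆
      {ω | Real.exp (-(p * ((k + 2 : ℕ) : ℝ) / 4)) ≤ Z ω} := by
    intro ω hω
    rw [Set.mem_ofPred_eq] at hω ⊢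
    have h1 : ∀ j, Real.exp (-(Y (j + 2) ω ^ 2 / s ^ 2)) ≤
        1 - (1 - q) * (B (j + 2)).indicator (fun _ => (1 : ℝ)) ω := by
      intro j
      by_cases h : ω ∈ B (j + 2)
      · simp only [h, Set.indicator_of_mem, mul_one, sub_sub_cancel]
        rw [hq, Real.exp_le_exp, neg_le_neg_iff, le_div_iff₀ (by positivity), one_mul,
          ← sq_abs (Y _ _)]
        have : s ≤ |Y (j + 2) ω| := h
        gcongr
      · simp only [h, not_false_eq_true, Set.indicator_of_notMem, mul_zero, sub_zero]
        rw [Real.exp_le_one_iff, neg_nonpos]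
        positivity
    have h2 : Real.exp (∑ j ∈ Finset.range k, -(Y (j + 2) ω ^ 2 / s ^ 2)) ≤ Z ω := by
      rw [Real.exp_sum]
      exact Finset.prod_le_prod (fun _ _ => (Real.exp_pos _).le) fun j _ => h1 j
    refine le_trans (Real.exp_le_exp.2 ?_) h2
    rw [Finset.sum_neg_distrib, neg_le_neg_iff, ← Finset.sum_div, div_le_iff₀ (by positivity)]
    -- The terms `t = 0, 1` are outside the small-ball condition and are dropped as nonnegative.
    rw [Finset.sum_range_succ', Finset.sum_range_succ'] at hω
    have : 0 ≤ Y (0 + 1) ω ^ 2 + Y 0 ω ^ 2 := by positivity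
    simp only [add_assoc, one_add_one_eq_two] at hω
    nlinarith
  have hmarkov := mul_meas_ge_le_integral_of_nonneg (Eventually.of_forall hZ0) hZi
    (Real.exp (-(p * ((k + 2 : ℕ) : ℝ) / 4)))
  have hk : (3 : ℝ) ≤ k := by exact_mod_cast (by omega : 3 ≤ k)
  have hpow : (1 - p * (1 - q)) ^ k ≤ Real.exp (-(p * (3 / 5)) * k) := by
    rw [mul_comm _ (k : ℝ), Real.exp_nat_mul]
    refine pow_le_pow_left₀ (by nlinarith) ?_ k
    have := Real.add_one_le_exp (-(p * (3 / 5)))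
    nlinarith
  have hfin : Real.exp (-(p * ((k + 2 : ℕ) : ℝ) / 4)) *
      μ.real {ω | ∑ t ∈ Finset.range (k + 2), Y t ω ^ 2 < s ^ 2 * (p * ((k + 2 : ℕ) : ℝ)) / 4} ≤
      Real.exp (-(p * (3 / 5)) * k) :=
    le_trans (mul_le_mul_of_nonneg_left (measureReal_mono hsub) (Real.exp_pos _).le)
      (hmarkov.trans (hint.trans hpow))
  rw [← le_div_iff₀' (Real.exp_pos _), ← Real.exp_sub] at hfin
  refine hfin.trans (Real.exp_le_exp.2 ?_)
  -- What remains is `T / 4 - 3 (T - 2) / 5 ≤ -T / 10`, that is, `T ≥ 4.8`; hence the hypothesis `5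
  -- ≤ T`.
  push_cast
  nlinarith [mul_le_mul_of_nonneg_left hk hp0]

/-- The exponential supermartingale of a sub-Gaussian martingale transform. -/
theorem lintegral_exp_sum_le_one {Ω : Type*} [m₀ : MeasurableSpace Ω] {μ : Measure Ω}
    [IsProbabilityMeasure μ] {G : ℕ → MeasurableSpace Ω} (hG : ∀ t, G t ≤ m₀) {W Y : ℕ → Ω → ℝ}
    (hY : ∀ i t, i ≤ t → Measurable[G t] (Y i)) (hW : ∀ i t, i < t → Measurable[G t] (W i))
    (hWm : ∀ t, Measurable (W t))
    (hind : ∀ t, Indep (G t) (MeasurableSpace.comap (W t) inferInstance) μ) {c : ℝ≥0}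
    (hsub : ∀ t, HasSubgaussianMGF (W t) c μ) (T : ℕ) :
    ∫⁻ ω, ENNReal.ofReal (Real.exp (∑ t ∈ Finset.range T, W t ω * Y t ω -
      c / 2 * ∑ t ∈ Finset.range T, Y t ω ^ 2)) ∂μ ≤ 1 := by
  induction T with
  | zero => simp
  | succ T ih =>
    refine le_trans ?_ ih
    set M : Ω → ℝ := fun ω => ∑ t ∈ Finset.range T, W t ω * Y t ω -
      c / 2 * ∑ t ∈ Finset.range T, Y t ω ^ 2 with hM
    have hMG : Measurable[G T] M := by
      refine Measurable.sub (Finset.measurable_sum _ fun i hi => ?_)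
        (Measurable.const_mul (Finset.measurable_sum _ fun i hi => ?_) _)
      · have := Finset.mem_range.1 hi
        exact (hW i T this).mul (hY i T this.le)
      · exact (hY i T (Finset.mem_range.1 hi).le).pow_const 2
    -- The pair `(M, Y T)` is past data, independent of `W T`, so `W T` can be integrated out first.
    -- The lower integral spares any integrability of the product.
    have hpair : Measurable[G T] fun ω => (M ω, Y T ω) := hMG.prodMk (hY T T le_rfl)
    have hi : IndepFun (fun ω => (M ω, Y T ω)) (W T) μ :=
      indep_of_indep_of_le_left (hind T) hpair.comap_le
    have hpair' : Measurable fun ω => (M ω, Y T ω) := hpair.mono (hG T) le_rfl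
    have hmap := hi.map_prod_eq_prod_map_map hpair'.aemeasurable (hWm T).aemeasurable
    have e1 : ∀ ω, ENNReal.ofReal (Real.exp (∑ t ∈ Finset.range (T + 1), W t ω * Y t ω -
        c / 2 * ∑ t ∈ Finset.range (T + 1), Y t ω ^ 2)) =
        (fun q : (ℝ × ℝ) × ℝ => ENNReal.ofReal (Real.exp (q.1.1 - c / 2 * q.1.2 ^ 2)) *
          ENNReal.ofReal (Real.exp (q.1.2 * q.2))) ((M ω, Y T ω), W T ω) := by
      intro ω
      simp only [hM, Finset.sum_range_succ]
      rw [← ENNReal.ofReal_mul (Real.exp_pos _).le, ← Real.exp_add]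
      congr 2
      ring
    have hmeas : Measurable (fun q : (ℝ × ℝ) × ℝ =>
        ENNReal.ofReal (Real.exp (q.1.1 - c / 2 * q.1.2 ^ 2)) *
          ENNReal.ofReal (Real.exp (q.1.2 * q.2))) := by fun_prop
    simp only [e1]
    rw [← lintegral_map (g := fun ω => ((M ω, Y T ω), W T ω)) hmeas (hpair'.prodMk (hWm T)), hmap,
      lintegral_prod _ hmeas.aemeasurable]
    -- The compensator `c / 2 * Y²` exactly cancels the sub-Gaussian bound on the moment generating
    -- function.
    have hinner : ∀ q : ℝ × ℝ, ∫⁻ z, ENNReal.ofReal (Real.exp (q.1 - c / 2 * q.2 ^ 2)) *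
        ENNReal.ofReal (Real.exp (q.2 * z)) ∂(μ.map (W T)) ≤ ENNReal.ofReal (Real.exp q.1) := by
      intro q
      rw [lintegral_const_mul _ (by fun_prop), lintegral_map (by fun_prop) (hWm T),
        ← ofReal_integral_eq_lintegral_ofReal ((hsub T).integrable_exp_mul q.2)
          (Eventually.of_forall fun _ => (Real.exp_pos _).le),
        ← ENNReal.ofReal_mul (Real.exp_pos _).le]
      refine ENNReal.ofReal_le_ofReal ?_
      have h1 := (hsub T).mgf_le q.2
      rw [mgf] at h1
      calc _ ≤ Real.exp (q.1 - c / 2 * q.2 ^ 2) * Real.exp (c * q.2 ^ 2 / 2) := by gcongr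
        _ = Real.exp q.1 := by rw [← Real.exp_add]; congr 1; ring
    refine (lintegral_mono hinner).trans ?_
    rw [lintegral_map (by fun_prop) hpair']

/-- Deviation bound for a sub-Gaussian martingale transform. -/
theorem measureReal_transform_ge_le {Ω : Type*} [m₀ : MeasurableSpace Ω] {μ : Measure Ω}
    [IsProbabilityMeasure μ] {G : ℕ → MeasurableSpace Ω} (hG : ∀ t, G t ≤ m₀) {W Y : ℕ → Ω → ℝ}
    (hY : ∀ i t, i ≤ t → Measurable[G t] (Y i)) (hW : ∀ i t, i < t → Measurable[G t] (W i))
    (hWm : ∀ t, Measurable (W t))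
    (hind : ∀ t, Indep (G t) (MeasurableSpace.comap (W t) inferInstance) μ) {c : ℝ≥0}
    (hsub : ∀ t, HasSubgaussianMGF (W t) c μ) (T : ℕ) (Q : ℝ) :
    μ.real {ω | c / 2 * ∑ t ∈ Finset.range T, Y t ω ^ 2 + Q <
      ∑ t ∈ Finset.range T, W t ω * Y t ω} ≤ Real.exp (-Q) := by
  have h1 := lintegral_exp_sum_le_one hG hY hW hWm hind hsub T
  have hYm : ∀ t, Measurable (Y t) := fun t => (hY t t le_rfl).mono (hG t) le_rfl
  have h2 := mul_meas_ge_le_lintegral₀ (μ := μ)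
    (f := fun ω => ENNReal.ofReal (Real.exp (∑ t ∈ Finset.range T, W t ω * Y t ω -
      c / 2 * ∑ t ∈ Finset.range T, Y t ω ^ 2))) (by fun_prop) (ENNReal.ofReal (Real.exp Q))
  have h3 : {ω | c / 2 * ∑ t ∈ Finset.range T, Y t ω ^ 2 + Q <
      ∑ t ∈ Finset.range T, W t ω * Y t ω} ⊆ {ω | ENNReal.ofReal (Real.exp Q) ≤
        ENNReal.ofReal (Real.exp (∑ t ∈ Finset.range T, W t ω * Y t ω -
          c / 2 * ∑ t ∈ Finset.range T, Y t ω ^ 2))} := by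
    intro ω hω
    rw [Set.mem_ofPred_eq] at hω ⊢
    exact ENNReal.ofReal_le_ofReal (Real.exp_le_exp.2 (by linarith))
  have h4 := ((mul_le_mul_right (measure_mono h3) _).trans h2).trans h1
  have h5 := ENNReal.toReal_mono ENNReal.one_ne_top h4
  rw [ENNReal.toReal_mul, ENNReal.toReal_ofReal (Real.exp_pos _).le, ENNReal.toReal_one,
    ← le_div_iff₀' (Real.exp_pos _), one_div, ← Real.exp_neg] at h5
  exact h5

/-! ### Small-ball consequences and numerical constants -/

theorem sqrt_dotProduct_sq_smul_one {n : ℕ} {s : ℝ} (hs : 0 ≤ s) {v : Vec n} (hv : ‖v‖ = 1) :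
    √(v.ofLp ⬝ᵥ ((s ^ 2 • (1 : Matrix (Fin n) (Fin n) ℝ)) *ᵥ v.ofLp)) = s := by
  have h1 : v.ofLp ⬝ᵥ v.ofLp = 1 := by
    have := EuclideanSpace.real_norm_sq_eq v
    rw [hv] at this
    simp only [dotProduct, ← sq]
    linarith
  rw [Matrix.smul_mulVec, Matrix.one_mulVec, dotProduct_smul, h1, smul_eq_mul, mul_one,
    Real.sqrt_sq hs]

theorem IsBMSB.condProb_ge {Ω : Type*} [m₀ : MeasurableSpace Ω] {μ : Measure Ω} {n : ℕ}
    {ℱ : ℕ → MeasurableSpace Ω} {y : ℕ → Ω → Vec n} {s p : ℝ} (hs : 0 < s)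
    (h : IsBMSB μ ℱ y 1 (s ^ 2 • (1 : Matrix (Fin n) (Fin n) ℝ)) p) {v : Vec n} (hv : ‖v‖ = 1)
    {t : ℕ} (ht : 1 ≤ t) :
    ∀ᵐ ω ∂μ, p ≤ (μ⟦{ω' | s ≤ |inner ℝ v (y (t + 1) ω')|} | ℱ t⟧) ω := by
  have := h.small_ball v hv t ht
  simpa [sqrt_dotProduct_sq_smul_one hs.le hv] using this

/-- Markov's inequality for `‖y 2‖²`, with Cauchy–Schwarz in one unit direction. It makes `b`
positive and bounds `b / (δ s² p)` below by `1 / δ`, which gives the logarithms of the burn-in time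
their sign. -/
theorem IsBMSB.mul_sq_le {Ω : Type*} [m₀ : MeasurableSpace Ω] {μ : Measure Ω}
    [IsProbabilityMeasure μ] {n : ℕ} [NeZero n]
    {ℱ : ℕ → MeasurableSpace Ω} {y : ℕ → Ω → Vec n} {s p b : ℝ} (hs : 0 < s)
    (h : IsBMSB μ ℱ y 1 (s ^ 2 • (1 : Matrix (Fin n) (Fin n) ℝ)) p)
    (hyi : ∀ t, Integrable (fun ω => ‖y t ω‖ ^ 2) μ) (hb : ∀ t, ∫ ω, ‖y t ω‖ ^ 2 ∂μ ≤ b) :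
    p * s ^ 2 ≤ b := by
  obtain ⟨v, hv⟩ := exists_norm_eq (Vec n) zero_le_one
  have hp := h.condProb_ge hs hv le_rfl
  set E : Set Ω := {ω' | s ≤ |inner ℝ v (y (1 + 1) ω')|} with hE
  have hym : Measurable (y 2) := (h.adapted 2 (by norm_num)).mono (h.filtration_le 2 (by norm_num))
    le_rfl
  have hEm : MeasurableSet E := measurableSet_le measurable_const (by fun_prop)
  have h1 : p ≤ μ.real E := by
    have h2 := integral_mono_ae (integrable_const p) integrable_condExp hp
    rw [integral_condExp (h.filtration_le 1 le_rfl), integral_indicator hEm] at h2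
    simpa [measureReal_def] using h2
  have h3 := mul_meas_ge_le_integral_of_nonneg (Eventually.of_forall fun ω => by positivity)
    (hyi 2) (s ^ 2)
  have h4 : E ⊆ {ω | s ^ 2 ≤ ‖y 2 ω‖ ^ 2} := by
    intro ω hω
    have hω' : s ≤ |inner ℝ v (y 2 ω)| := hω
    have := hω'.trans (abs_real_inner_le_norm v (y 2 ω))
    rw [hv, one_mul] at this
    exact pow_le_pow_left₀ hs.le this 2
  have h5 := measureReal_mono (μ := μ) h4
  have h6 : s ^ 2 * p ≤ s ^ 2 * μ.real {ω | s ^ 2 ≤ ‖y 2 ω‖ ^ 2} := by gcongr; linarith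
  linarith [hb 2]

/-- This is where the burn-in time is used: it gives `exp (-pT / 10) ≤ δ (p² / (100 B))^m`, and each
of the `m` factors pays for one factor `48 √R` of the net cardinality, because `√R ≤ R = B / p`. -/
theorem net_card_mul_exp_le {m : ℕ} {p B R δ T : ℝ} (hp : 0 < p) (hp1 : p ≤ 1) (hB : 0 < B)
    (hR : B = R * p) (hR1 : 1 ≤ R) (hδ : 0 < δ)
    (hT : 10 / p * (Real.log (1 / δ) + 2 * m * Real.log (10 / p) + m * Real.log B) ≤ T) :
    (48 * √R) ^ m * Real.exp (-(p * T / 10)) ≤ δ := by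
  have h1 : Real.log (1 / δ) + 2 * m * Real.log (10 / p) + m * Real.log B ≤ p * T / 10 := by
    rw [div_mul_eq_mul_div, div_le_iff₀ hp] at hT
    linarith
  have h2 : Real.exp (-(p * T / 10)) ≤ δ * (p ^ 2 / (100 * B)) ^ m := by
    have h3 : Real.log (δ * (p ^ 2 / (100 * B)) ^ m) =
        -(Real.log (1 / δ) + 2 * m * Real.log (10 / p) + m * Real.log B) := by
      have h100 : (100 : ℝ) = 10 ^ 2 := by norm_num
      rw [Real.log_mul hδ.ne' (by positivity), Real.log_pow, Real.log_div (by positivity)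
        (by positivity), Real.log_mul (by norm_num) hB.ne', Real.log_pow, one_div, Real.log_inv,
        Real.log_div (by norm_num) hp.ne', h100, Real.log_pow]
      push_cast
      ring
    rw [← Real.le_log_iff_exp_le (by positivity), h3]
    linarith
  refine (mul_le_mul_of_nonneg_left h2 (by positivity)).trans ?_
  have h4 : 48 * √R * (p ^ 2 / (100 * B)) ≤ 1 := by
    have h5 : √R ≤ R := Real.sqrt_le_iff.2 ⟨by linarith, by nlinarith⟩
    rw [hR, mul_div_assoc', div_le_one (by positivity)]
    have : √R * p ≤ R * 1 := by gcongr
    nlinarith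
  calc (48 * √R) ^ m * (δ * (p ^ 2 / (100 * B)) ^ m)
      = δ * (48 * √R * (p ^ 2 / (100 * B))) ^ m := by
        rw [mul_pow (48 * √R) (p ^ 2 / (100 * B)), mul_left_comm]
    _ ≤ δ * 1 := by gcongr; exact pow_le_one₀ (by positivity) h4
    _ = δ := mul_one δ

/-- The logarithm of the number of net points divided by the failure probability. -/
theorem noise_level_le {n m : ℕ} {p B R δ : ℝ} (hp : 0 < p) (hR : B = R * p) (hR1 : 1 ≤ R)
    (hδ : 0 < δ) (hδ1 : δ < 1) :
    n * Real.log 12 + m * Real.log (48 * √R) + Real.log (1 / δ) ≤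
      9 * (n + Real.log (1 / δ) + m * Real.log (10 / p) + m * Real.log B) := by
  have h12 : Real.log 12 ≤ 9 := by
    have := Real.log_le_sub_one_of_pos (show (0 : ℝ) < 12 / 4 by norm_num)
    have h4 := Real.log_le_sub_one_of_pos (show (0 : ℝ) < 4 by norm_num)
    rw [Real.log_div (by norm_num) (by norm_num)] at this
    linarith
  have hδ' : 0 ≤ Real.log (1 / δ) := Real.log_nonneg (by rw [le_div_iff₀ hδ]; linarith)
  have hR0 : 0 < R := by linarith
  -- Both sides are expressed through `R`, since `10 / p * B = 10 R`; the bound then follows from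
  -- `48 ≤ 10²` and `R ≥ 1`.
  have h48 : Real.log (48 * √R) ≤ 9 * (Real.log (10 / p) + Real.log B) := by
    rw [← Real.log_mul (by positivity) (by rw [hR]; positivity)]
    have : 10 / p * B = 10 * R := by rw [hR]; field_simp
    rw [this, Real.log_mul (by norm_num) (by positivity), Real.log_sqrt hR0.le,
      Real.log_mul (by norm_num) hR0.ne']
    have h1 : Real.log 48 ≤ Real.log (10 ^ 2) := Real.log_le_log (by norm_num) (by norm_num)
    rw [Real.log_pow] at h1
    have h2 := Real.log_nonneg hR1
    have h3 : 0 ≤ Real.log 10 := Real.log_nonneg (by norm_num)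
    push_cast at h1
    linarith
  have hn : (n : ℝ) * Real.log 12 ≤ n * 9 := by gcongr
  have hm : (m : ℝ) * Real.log (48 * √R) ≤ m * (9 * (Real.log (10 / p) + Real.log B)) := by gcongr
  linarith

/-- The scale `√Q' / σ` makes the quadratic and the deviation term comparable: together they are `57
/ 8 * Q'`. Dividing by `a` gives `57 / 2`, the factor `9` contributes `√9 = 3`, and `171 / 2 ≤ 90`.
Finally `p ≤ √p` replaces `1 / √p` by `1 / p`. -/
theorem rate_le {Q' Q s p σ T a : ℝ} (hQ' : 0 < Q') (hQ : Q' ≤ 9 * Q) (hs : 0 < s)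
    (hp : 0 < p) (hp1 : p ≤ 1) (hσ : 0 < σ) (hT : 0 < T) (ha : a = s * √(p * T) / 4) :
    4 * (25 / 32 * σ ^ 2 * (√Q' / σ) ^ 2 + Q') / (a * (√Q' / σ)) ≤
      90 * σ / p * √(Q / (T * s ^ 2)) := by
  have hQ0 : 0 < Q := by linarith
  have h1 : √Q' ≤ 3 * √Q := by
    rw [show (3 : ℝ) * √Q = √(9 * Q) by
      rw [Real.sqrt_mul (by norm_num), show (9 : ℝ) = 3 ^ 2 by norm_num, Real.sqrt_sq (by norm_num)]]
    exact Real.sqrt_le_sqrt hQ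
  have hq := Real.sq_sqrt hQ'.le
  have hq0 := Real.sqrt_pos.2 hQ'
  have hp2 : p ≤ √p := by
    rw [Real.le_sqrt' hp]
    nlinarith
  have hsp := Real.sqrt_pos.2 hp
  have hsT := Real.sqrt_pos.2 hT
  have e1 : 4 * (25 / 32 * σ ^ 2 * (√Q' / σ) ^ 2 + Q') / (a * (√Q' / σ)) =
      57 / 2 * σ * √Q' / (s * √p * √T) := by
    rw [ha, Real.sqrt_mul hp.le]
    conv_lhs => rw [show 4 * (25 / 32 * σ ^ 2 * (√Q' / σ) ^ 2 + Q') = 57 / 8 * √Q' ^ 2 by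
      rw [hq]; field_simp; rw [hq]; ring]
    field_simp
    ring
  rw [e1, Real.sqrt_div hQ0.le, Real.sqrt_mul hT.le, Real.sqrt_sq hs.le, div_mul_div_comm,
    div_le_div_iff₀ (by positivity) (by positivity)]
  have h2 : 57 / 2 * σ * √Q' ≤ 57 / 2 * σ * (3 * √Q) := by gcongr
  calc 57 / 2 * σ * √Q' * (p * (√T * s)) ≤ 57 / 2 * σ * (3 * √Q) * (√p * (√T * s)) := by gcongr
    _ ≤ 90 * σ * √Q * (s * √p * √T) := by
      have : 0 ≤ σ * √Q * (s * √p * √T) := by positivity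
      nlinarith

/-- A set whose complement is covered by three sets of measure at most `δ` has measure at least
`1 - 3δ`. -/
theorem one_sub_three_mul_le_measureReal {Ω : Type*} [MeasurableSpace Ω] {μ : Measure Ω}
    [IsProbabilityMeasure μ] {A E₁ E₂ E₃ : Set Ω} {δ : ℝ} (hA : MeasurableSet A)
    (hsub : Aᶜ ⊆ E₁ ∪ E₂ ∪ E₃) (h₁ : μ.real E₁ ≤ δ) (h₂ : μ.real E₂ ≤ δ) (h₃ : μ.real E₃ ≤ δ) :
    1 - 3 * δ ≤ μ.real A := by
  have h1 := measureReal_compl (μ := μ) hA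
  have h2 := measureReal_mono (μ := μ) hsub
  have h3 := measureReal_union_le (μ := μ) (E₁ ∪ E₂) E₃
  have h4 := measureReal_union_le (μ := μ) E₁ E₂
  simp only [probReal_univ] at h1
  linarith

/-- Persistence of excitation on the unit sphere from a net. -/
theorem le_norm_innerSeq_of_net {m T : ℕ} {y : ℕ → Vec m} {a ε : ℝ}
    (hup : ∀ v, ‖v‖ ≤ ε → ‖innerSeq y T v‖ ≤ a / 4) {N : Finset (Vec m)}
    (hN : ∀ v, ‖v‖ = 1 → ∃ v' ∈ N, ‖v - v'‖ ≤ ε) (ha : 0 < a)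
    (hlow : ∀ v ∈ N, (2 * a) ^ 2 ≤ ∑ t ∈ Finset.range T, (inner ℝ v (y t) : ℝ) ^ 2) (v : Vec m) :
    a * ‖v‖ ≤ ‖innerSeq y T v‖ := by
  have hunit : ∀ v, ‖v‖ = 1 → a ≤ ‖innerSeq y T v‖ := by
    intro v hv
    obtain ⟨v', hv', hd⟩ := hN v hv
    have h1 := hlow v' hv'
    rw [← norm_innerSeq_sq] at h1
    have h2 : 2 * a ≤ ‖innerSeq y T v'‖ := le_of_sq_le_sq h1 (norm_nonneg _)
    have h3 := hup _ hd
    rw [map_sub] at h3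
    have h4 := norm_sub_norm_le (innerSeq y T v') (innerSeq y T v)
    rw [norm_sub_rev] at h4
    linarith
  rcases eq_or_ne v 0 with rfl | hv
  · simp
  · have hv' := norm_pos_iff.2 hv
    have := hunit (‖v‖⁻¹ • v) (by rw [norm_smul, norm_inv, norm_norm, inv_mul_cancel₀ hv'.ne'])
    rw [map_smul, norm_smul, norm_inv, norm_norm, le_inv_mul_iff₀ hv'] at this
    linarith

theorem norm_innerSeq_le {m T : ℕ} {y : ℕ → Vec m} {C : ℝ} (hC : 0 ≤ C)
    (h : ∑ t ∈ Finset.range T, ‖y t‖ ^ 2 ≤ C ^ 2) (v : Vec m) :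
    ‖innerSeq y T v‖ ≤ C * ‖v‖ := by
  refine le_of_sq_le_sq ?_ (by positivity)
  rw [norm_innerSeq_sq]
  calc ∑ t ∈ Finset.range T, (inner ℝ v (y t) : ℝ) ^ 2
      ≤ ∑ t ∈ Finset.range T, ‖v‖ ^ 2 * ‖y t‖ ^ 2 := by
        refine Finset.sum_le_sum fun t _ => ?_
        rw [← mul_pow, ← sq_abs]
        exact pow_le_pow_left₀ (abs_nonneg _) (abs_real_inner_le_norm _ _) 2
    _ = ‖v‖ ^ 2 * ∑ t ∈ Finset.range T, ‖y t‖ ^ 2 := by rw [Finset.mul_sum]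
    _ ≤ ‖v‖ ^ 2 * C ^ 2 := by gcongr
    _ = (C * ‖v‖) ^ 2 := by ring

/-! ### Probabilistic error bound and its monotonicity -/

/-- The least squares error bound under the one-step small-ball condition. -/
theorem lseRate_of_isBMSB {Ω : Type*} [m₀ : MeasurableSpace Ω] {μ : Measure Ω}
    [IsProbabilityMeasure μ] {n m : ℕ} {θ : Matrix (Fin n) (Fin m) ℝ} {x w : ℕ → Ω → Vec n}
    {y : ℕ → Ω → Vec m} (hx : ∀ t ω, x (t + 1) ω = matVec θ (y t ω) + w t ω)
    {b s p σ : ℝ} (hyi : ∀ t, Integrable (fun ω => ‖y t ω‖ ^ 2) μ)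
    (hb : ∀ t, ∫ ω, ‖y t ω‖ ^ 2 ∂μ ≤ b) (hs : 0 < s) (hp : 0 < p) (hp1 : p < 1) (hσ : 0 < σ)
    {ℱ : ℕ → MeasurableSpace Ω}
    (hsb : IsBMSB μ ℱ y 1 (s ^ 2 • (1 : Matrix (Fin m) (Fin m) ℝ)) p)
    {G : ℕ → MeasurableSpace Ω} (hG : ∀ t, G t ≤ m₀)
    (hY : ∀ i t, i ≤ t → Measurable[G t] (y i)) (hW : ∀ i t, i < t → Measurable[G t] (w i))
    (hWm : ∀ t, Measurable (w t))
    (hind : ∀ t, Indep (G t) (MeasurableSpace.comap (w t) inferInstance) μ)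
    (hsub : ∀ t, SubgaussianVec μ (w t) σ) :
    LSERate μ θ x y s p b σ := by
  intro δ T hδ hδ1 hT1 hT
  -- For `δ ≥ 1 / 3` the required probability is at most zero. Otherwise `1 / δ > 3 > e`, which
  -- yields `R ≥ 3` and `T ≥ 5` below.
  rcases le_or_gt (1 / 3) δ with hδ3 | hδ3
  · exact ⟨∅, .empty, by simp; linarith, by simp⟩
  rcases Nat.eq_zero_or_pos n with rfl | hn
  · refine ⟨Set.univ, .univ, by simp; linarith, fun ω _ θ' _ => ?_⟩
    rw [Subsingleton.elim θ' θ, sub_self, norm_zero]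
    positivity
  rcases Nat.eq_zero_or_pos m with rfl | hm
  · refine ⟨Set.univ, .univ, by simp; linarith, fun ω _ θ' _ => ?_⟩
    rw [Subsingleton.elim θ' θ, sub_self, norm_zero]
    positivity
  have : NeZero n := ⟨hn.ne'⟩
  have : NeZero m := ⟨hm.ne'⟩
  have hym : ∀ t, Measurable (y t) := fun t => (hY t t le_rfl).mono (hG t) le_rfl
  have hinner : ∀ {k : ℕ} (v : Vec k), Measurable fun z : Vec k => (inner ℝ v z : ℝ) := fun v => by
    fun_prop
  have hbp := hsb.mul_sq_le hs hyi hb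
  have hb0 : 0 < b := lt_of_lt_of_le (by positivity) hbp
  set B : ℝ := b / (δ * s ^ 2) with hBdef
  have hB0 : 0 < B := by positivity
  set R : ℝ := B / p with hRdef
  have hBR : B = R * p := by rw [hRdef]; field_simp
  have hR3 : 3 ≤ R := by
    rw [hRdef, hBdef, div_div, le_div_iff₀ (by positivity)]
    nlinarith [mul_pos hp (pow_pos hs 2)]
  have hR1 : 1 ≤ R := by linarith
  have hsR : 1 ≤ √R := Real.one_le_sqrt.2 hR1
  have hT0 : (0 : ℝ) < T := by exact_mod_cast hT1
  have hT5 : 5 ≤ T := by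
    have h1 : 1 ≤ Real.log (1 / δ) := by
      rw [Real.le_log_iff_exp_le (by positivity), le_div_iff₀ hδ]
      nlinarith [Real.exp_one_lt_d9, Real.exp_pos 1]
    have h2 : 0 ≤ Real.log (10 / p) :=
      Real.log_nonneg (by rw [le_div_iff₀ hp]; linarith)
    have h3 : 0 ≤ Real.log (10 / p) + Real.log B := by
      rw [← Real.log_mul (by positivity) hB0.ne']
      refine Real.log_nonneg ?_
      rw [hBR]
      field_simp
      linarith
    have h4 : (1 : ℝ) ≤ Real.log (1 / δ) + 2 * m * Real.log (10 / p) + m * Real.log B := by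
      have : 0 ≤ (m : ℝ) * Real.log (10 / p) + m * (Real.log (10 / p) + Real.log B) := by
        positivity
      linarith
    have h5 : (10 : ℝ) ≤ 10 / p := by rw [le_div_iff₀ hp]; linarith
    have h6 : (5 : ℝ) ≤ T := by nlinarith
    exact_mod_cast h6
  -- Off the event `E₁`, `‖V v‖ ≤ s √(T B) ‖v‖`, and this mesh gives `s √(T B) ε = a / 4`.
  set ε : ℝ := 1 / (16 * √R) with hεdef
  have hε0 : 0 < ε := by positivity
  have hε1 : ε ≤ 1 := by rw [hεdef, div_le_one (by positivity)]; linarith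
  have h3ε : 3 / ε = 48 * √R := by rw [hεdef]; field_simp; norm_num
  -- The small-ball condition speaks of unit vectors, so excitation needs a net of the sphere; the
  -- noise bound needs a net of the whole ball.
  obtain ⟨Ns, hNs1, hNs, hNsc⟩ := exists_finset_net (A := {v : Vec m | ‖v‖ = 1})
    (fun v hv => le_of_eq hv) hε0 hε1
  obtain ⟨Nv, -, hNv, hNvc⟩ := exists_finset_net (A := {v : Vec m | ‖v‖ ≤ 1})
    (fun v hv => hv) hε0 hε1
  obtain ⟨Nu, hNu1, hNu, hNuc⟩ := exists_finset_net (A := {u : Vec n | ‖u‖ = 1})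
    (fun v hv => le_of_eq hv) (ε := 1 / 4) (by norm_num) (by norm_num)
  rw [finrank_euclideanSpace_fin, h3ε] at hNsc hNvc
  rw [finrank_euclideanSpace_fin, show (3 : ℝ) / (1 / 4) = 12 by norm_num] at hNuc
  -- `(2a)²` is the threshold of the lower tail bound; half of it is spent on passing from the net
  -- to the sphere.
  set a : ℝ := s * √(p * T) / 4 with hadef
  have ha : 0 < a := by positivity
  -- Chosen so that the union bound over both noise nets costs exactly `δ`.
  set Q : ℝ := n * Real.log 12 + m * Real.log (48 * √R) + Real.log (1 / δ) with hQdef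
  have hQ0 : 0 < Q := by
    have h1 : 0 < Real.log (1 / δ) := Real.log_pos (by rw [lt_div_iff₀ hδ]; linarith)
    have h2 : 0 ≤ Real.log (48 * √R) := Real.log_nonneg (by linarith)
    have h3 : 0 ≤ Real.log 12 := Real.log_nonneg (by norm_num)
    positivity
  have hQexp : (12 : ℝ) ^ n * (48 * √R) ^ m * Real.exp (-Q) = δ := by
    have : Real.exp (-Q) = ((12 : ℝ) ^ n * (48 * √R) ^ m)⁻¹ * δ := by
      rw [hQdef, ← Real.log_pow, ← Real.log_pow, ← Real.log_mul (by positivity) (by positivity),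
        ← Real.log_mul (by positivity) (by positivity), Real.exp_neg,
        Real.exp_log (by positivity)]
      field_simp
    rw [this]
    field_simp
  set r : ℝ := √Q / σ with hrdef
  have hr : 0 < r := by positivity
  let E₁ : Set Ω := {ω | T * b / δ ≤ ∑ t ∈ Finset.range T, ‖y t ω‖ ^ 2}
  let E₂ : Set Ω := ⋃ v ∈ Ns, {ω | ∑ t ∈ Finset.range T, (inner ℝ v (y t ω) : ℝ) ^ 2 <
    s ^ 2 * (p * T) / 4}
  let E₃ : Set Ω := ⋃ q ∈ Nu ×ˢ Nv, {ω | σ ^ 2 / 2 *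
    ∑ t ∈ Finset.range T, (inner ℝ ((r / a) • q.2) (y t ω) : ℝ) ^ 2 + Q <
      ∑ t ∈ Finset.range T, inner ℝ q.1 (w t ω) * inner ℝ ((r / a) • q.2) (y t ω)}
  have hE₁m : MeasurableSet E₁ := measurableSet_le measurable_const (by fun_prop)
  have hE₂m : MeasurableSet E₂ := Finset.measurableSet_biUnion _ fun v _ =>
    measurableSet_lt (by fun_prop) measurable_const
  have hE₃m : MeasurableSet E₃ := Finset.measurableSet_biUnion _ fun v _ =>
    measurableSet_lt (by fun_prop) (by fun_prop)
  have hE₁ : μ.real E₁ ≤ δ := by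
    have h1 := mul_meas_ge_le_integral_of_nonneg (μ := μ)
      (f := fun ω => ∑ t ∈ Finset.range T, ‖y t ω‖ ^ 2)
      (Eventually.of_forall fun ω => Finset.sum_nonneg fun t _ => by positivity)
      (integrable_finsetSum _ fun t _ => hyi t) (T * b / δ)
    rw [integral_finsetSum _ fun t _ => hyi t] at h1
    have h2 : ∑ t ∈ Finset.range T, ∫ ω, ‖y t ω‖ ^ 2 ∂μ ≤ T * b := by
      calc _ ≤ ∑ t ∈ Finset.range T, b := Finset.sum_le_sum fun t _ => hb t
        _ = T * b := by simp
    have h3 := h1.trans h2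
    have hTb : 0 < T * b := by positivity
    rw [div_mul_eq_mul_div, div_le_iff₀ hδ] at h3
    exact le_of_mul_le_mul_left h3 hTb
  have hE₂ : μ.real E₂ ≤ δ := by
    refine (measureReal_biUnion_finset_le _ _).trans ?_
    have h1 : ∀ v ∈ Ns, μ.real {ω | ∑ t ∈ Finset.range T, (inner ℝ v (y t ω) : ℝ) ^ 2 <
        s ^ 2 * (p * T) / 4} ≤ Real.exp (-(p * T / 10)) := by
      intro v hv
      refine measureReal_sum_sq_lt_le hsb.filtration_le hsb.filtration_mono
        (Y := fun t ω => inner ℝ v (y t ω)) (fun t ht => ?_) hs hp.le hp1.le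
        (fun t ht => hsb.condProb_ge hs (hNs1 v hv) ht) hT5
      exact (hinner v).comp (hsb.adapted t ht)
    refine (Finset.sum_le_sum h1).trans ?_
    rw [Finset.sum_const, nsmul_eq_mul]
    exact (mul_le_mul_of_nonneg_right hNsc (Real.exp_pos _).le).trans
      (net_card_mul_exp_le hp hp1.le hB0 hBR hR1 hδ hT)
  have hE₃ : μ.real E₃ ≤ δ := by
    refine (measureReal_biUnion_finset_le _ _).trans ?_
    have h1 : ∀ q ∈ Nu ×ˢ Nv, μ.real {ω | σ ^ 2 / 2 *
        ∑ t ∈ Finset.range T, (inner ℝ ((r / a) • q.2) (y t ω) : ℝ) ^ 2 + Q <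
        ∑ t ∈ Finset.range T, inner ℝ q.1 (w t ω) * inner ℝ ((r / a) • q.2) (y t ω)} ≤
        Real.exp (-Q) := by
      intro q hq
      have hq1 : ‖q.1‖ = 1 := hNu1 q.1 (Finset.mem_product.1 hq).1
      have h2 := measureReal_transform_ge_le (μ := μ) hG (W := fun t ω => inner ℝ q.1 (w t ω))
        (Y := fun t ω => inner ℝ ((r / a) • q.2) (y t ω))
        (fun i t hit => (hinner _).comp (hY i t hit))
        (fun i t hit => (hinner _).comp (hW i t hit))
        (fun t => (hinner _).comp (hWm t))
        (fun t => indep_of_indep_of_le_right (hind t)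
          (by
            have : (fun ω => (inner ℝ q.1 (w t ω) : ℝ)) = (fun z => inner ℝ q.1 z) ∘ w t := rfl
            rw [this, ← MeasurableSpace.comap_comp]
            exact MeasurableSpace.comap_mono (hinner _).comap_le))
        (fun t => hsub t q.1 hq1) T Q
      rwa [Real.coe_toNNReal _ (sq_nonneg σ)] at h2
    refine (Finset.sum_le_sum h1).trans ?_
    rw [Finset.sum_const, nsmul_eq_mul, Finset.card_product, ← hQexp]
    rw [Nat.cast_mul]
    exact mul_le_mul_of_nonneg_right (mul_le_mul hNuc hNvc (Nat.cast_nonneg _) (by positivity))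
      (Real.exp_pos _).le
  refine ⟨(E₁ ∪ E₂ ∪ E₃)ᶜ, ((hE₁m.union hE₂m).union hE₃m).compl,
    one_sub_three_mul_le_measureReal ((hE₁m.union hE₂m).union hE₃m).compl (by rw [compl_compl])
      hE₁ hE₂ hE₃, fun ω hω θ' hθ' => ?_⟩
  simp only [Set.compl_union, Set.mem_inter_iff] at hω
  obtain ⟨⟨hω₁, hω₂⟩, hω₃⟩ := hω
  have hω₁' : ∑ t ∈ Finset.range T, ‖y t ω‖ ^ 2 ≤ (s * √(T * B)) ^ 2 := by
    have h1 : (s * √(T * B)) ^ 2 = T * b / δ := by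
      rw [mul_pow, Real.sq_sqrt (by positivity), hBdef]
      field_simp
    rw [h1]
    exact (not_le.1 fun h => hω₁ h).le
  have hup : ∀ v, ‖v‖ ≤ ε → ‖innerSeq (fun t => y t ω) T v‖ ≤ a / 4 := by
    intro v hv
    refine (norm_innerSeq_le (by positivity) hω₁' v).trans ?_
    have h1 : √(T * B) = √(p * T) * √R := by
      rw [← Real.sqrt_mul (by positivity), hBR]
      congr 1
      ring
    calc s * √(T * B) * ‖v‖ ≤ s * √(T * B) * ε := by gcongr
      _ = a / 4 := by
        rw [h1, hεdef, hadef]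
        field_simp
        norm_num
  have hlow : ∀ v, a * ‖v‖ ≤ ‖innerSeq (fun t => y t ω) T v‖ := by
    refine le_norm_innerSeq_of_net hup hNs ha fun v hv => ?_
    have h1 : (2 * a) ^ 2 = s ^ 2 * (p * T) / 4 := by
      rw [hadef, mul_pow, div_pow, mul_pow, Real.sq_sqrt (by positivity)]
      ring
    rw [h1]
    by_contra! hlt
    exact hω₂ (Set.mem_biUnion hv hlt)
  refine (hθ'.norm_sub_le (fun t => hx t ω) ha hr (sq_nonneg σ) hlow hup hNu1 hNu hNv (Q := Q)
    fun u hu v hv => ?_).trans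
    (rate_le hQ0 (noise_level_le hp hBR hR1 hδ hδ1) hs hp hp1.le hσ hT0 hadef)
  by_contra! hlt
  exact hω₃ (Set.mem_biUnion (Finset.mem_coe.2 (Finset.mk_mem_product hu hv)) hlt)

/-- A smaller `s'` lengthens the burn-in time and enlarges the logarithm, and elsewhere the bound
depends on the noise and small-ball levels only through their ratio. This lets a smaller small-ball
level absorb a larger sub-Gaussian constant. -/
theorem LSERate.mono {Ω : Type*} [MeasurableSpace Ω] {μ : Measure Ω} {n m : ℕ}
    {θ : Matrix (Fin n) (Fin m) ℝ} {x : ℕ → Ω → Vec n} {y : ℕ → Ω → Vec m}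
    {s s' p b σ σ' : ℝ} (h : LSERate μ θ x y s p b σ) (hs' : 0 < s') (hss : s' ≤ s) (hp : 0 < p)
    (hb : 0 ≤ b) (hσ' : 0 ≤ σ') (hσ : σ / s ≤ σ' / s') : LSERate μ θ x y s' p b σ' := by
  intro δ T hδ hδ1 hT1 hT
  have hs : 0 < s := hs'.trans_le hss
  have hlog : Real.log (b / (δ * s ^ 2)) ≤ Real.log (b / (δ * s' ^ 2)) := by
    -- For `b = 0` both logarithms take the default value `Real.log 0 = 0`.
    rcases hb.eq_or_lt with rfl | hb
    · simp
    · exact Real.log_le_log (by positivity) (by gcongr)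
  obtain ⟨A, hA, hμ, hbd⟩ := h δ T hδ hδ1 hT1 (le_trans (by gcongr) hT)
  refine ⟨A, hA, hμ, fun ω hω θ' hθ' => (hbd ω hω θ' hθ').trans ?_⟩
  have hT0 : (0 : ℝ) < T := by exact_mod_cast hT1
  have hsplit : ∀ N r : ℝ, 0 < r → √(N / (T * r ^ 2)) = √(N / T) / r := by
    intro N r hr
    rw [← div_div, Real.sqrt_div' _ (sq_nonneg r), Real.sqrt_sq hr.le]
  rw [hsplit _ _ hs, hsplit _ _ hs']
  set N := n + Real.log (1 / δ) + m * Real.log (10 / p) + m * Real.log (b / (δ * s ^ 2)) with hN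
  set N' := n + Real.log (1 / δ) + m * Real.log (10 / p) + m * Real.log (b / (δ * s' ^ 2)) with hN'
  have h1 : √(N / T) ≤ √(N' / T) := by
    refine Real.sqrt_le_sqrt ?_
    rw [hN, hN']
    gcongr
  calc 90 * σ / p * (√(N / T) / s) = 90 / p * √(N / T) * (σ / s) := by ring
    _ ≤ 90 / p * √(N / T) * (σ' / s') := by gcongr
    _ ≤ 90 / p * √(N' / T) * (σ' / s') := by gcongr
    _ = 90 * σ' / p * (√(N' / T) / s') := by ring

/-! ### Small-ball bounds from analyticity and semi-continuous noise -/

/-- Lower bound for a conditional probability given `m` of an event determined by an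
`m`-measurable variable and a variable independent of `m`. -/
theorem le_condProb_of_indep {Ω α β : Type*} {m m₀ : MeasurableSpace Ω} {μ : Measure Ω}
    [IsProbabilityMeasure μ] [MeasurableSpace α] [MeasurableSpace β] (hm : m ≤ m₀) {X : Ω → α}
    (hX : Measurable[m] X) {N : Ω → β} (hN : Measurable N)
    (hind : Indep m (MeasurableSpace.comap N inferInstance) μ) {S : Set (α × β)}
    (hS : MeasurableSet S) {K : Set α} (hXK : ∀ᵐ ω ∂μ, X ω ∈ K) {p : ℝ}
    (hp : ∀ a ∈ K, p ≤ (μ.map N).real {b | (a, b) ∈ S}) :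
    ∀ᵐ ω ∂μ, p ≤ (μ⟦{ω' | (X ω', N ω') ∈ S} | m⟧) ω := by
  have hX₀ : Measurable X := hX.mono hm le_rfl
  set B : Set Ω := {ω' | (X ω', N ω') ∈ S} with hB
  have hBm : MeasurableSet B := (hX₀.prodMk hN) hS
  have hprob : IsProbabilityMeasure (μ.map N) := Measure.isProbabilityMeasure_map hN.aemeasurable
  -- It suffices to compare integrals over sets `A` of `m`, once the measure is restricted to `m`.
  refine ae_of_ae_trim hm (ae_le_of_forall_setIntegral_le (integrable_const p)
    (integrable_condExp.trim hm stronglyMeasurable_condExp) fun A hA _ => ?_)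
  rw [← setIntegral_trim hm stronglyMeasurable_condExp hA,
    ← setIntegral_trim hm stronglyMeasurable_const hA,
    setIntegral_condExp hm ((integrable_const _).indicator hBm) hA, setIntegral_const,
    integral_indicator hBm, setIntegral_const, smul_eq_mul, smul_eq_mul, mul_one,
    measureReal_restrict_apply hBm]
  have hA₀ : MeasurableSet A := hm _ hA
  -- Carrying the indicator of `A` along with `X` keeps the pair independent of `N`, so the
  -- probability of `B ∩ A` is a product integral over the law of `N`.
  set Z : Ω → ℝ := A.indicator fun _ => 1 with hZ
  have hZm : Measurable[m] Z := measurable_const.indicator hA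
  have hXZ : Measurable[m] fun ω => (X ω, Z ω) := hX.prodMk hZm
  have hXZ₀ : Measurable fun ω => (X ω, Z ω) := hXZ.mono hm le_rfl
  have hi : IndepFun (fun ω => (X ω, Z ω)) N μ := indep_of_indep_of_le_left hind hXZ.comap_le
  have hmap := hi.map_prod_eq_prod_map_map hXZ₀.aemeasurable hN.aemeasurable
  let S' : Set ((α × ℝ) × β) := {q | q.1.2 = 1 ∧ (q.1.1, q.2) ∈ S}
  have hS' : MeasurableSet S' :=
    ((measurableSet_singleton (1 : ℝ)).preimage (measurable_snd.comp measurable_fst)).inter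
      (hS.preimage ((measurable_fst.comp measurable_fst).prodMk measurable_snd))
  have hBA : μ (B ∩ A) = ∫⁻ ω, (μ.map N) (Prod.mk (X ω, Z ω) ⁻¹' S') ∂μ := by
    rw [← lintegral_map (g := fun ω => (X ω, Z ω)) (measurable_measure_prodMk_left hS') hXZ₀,
      ← Measure.prod_apply hS', ← hmap, Measure.map_apply (hXZ₀.prodMk hN) hS']
    congr 1
    ext ω
    by_cases h : ω ∈ A <;> simp [S', hB, hZ, h]
  have hge : ENNReal.ofReal p * μ A ≤ μ (B ∩ A) := by
    rw [hBA, ← setLIntegral_const, ← lintegral_indicator hA₀]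
    refine lintegral_mono_ae ?_
    filter_upwards [hXK] with ω hω
    by_cases h : ω ∈ A
    · have e : Prod.mk (X ω, Z ω) ⁻¹' S' = {b | (X ω, b) ∈ S} := by
        ext b
        simp [S', hZ, h]
      rw [e, Set.indicator_of_mem h, ← ofReal_measureReal]
      exact ENNReal.ofReal_le_ofReal (hp _ hω)
    · simp [h]
  have := ENNReal.toReal_mono (measure_ne_top _ _) hge
  rw [ENNReal.toReal_mul, ENNReal.toReal_ofReal'] at this
  refine le_trans ?_ this
  rw [mul_comm]
  exact mul_le_mul_of_nonneg_right (le_max_left _ _) ENNReal.toReal_nonneg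

/-- A continuous family of functions, each of which is nonzero with positive probability, is
bounded away from zero with uniformly positive probability on compact sets of parameters. -/
theorem exists_uniform_smallBall {α β : Type*} [TopologicalSpace α] [FirstCountableTopology α]
    [TopologicalSpace β] [MeasurableSpace β] [OpensMeasurableSpace β] {Q : Measure β}
    [IsProbabilityMeasure Q] {g : α → β → ℝ} (hg : Continuous fun q : α × β => g q.1 q.2)
    {K : Set α} (hK : IsCompact K) (hpos : ∀ a ∈ K, Q {b | g a b ≠ 0} ≠ 0) :
    ∃ s p : ℝ, 0 < s ∧ 0 < p ∧ p < 1 ∧ ∀ a ∈ K, ∀ s', s' ≤ s → p ≤ Q.real {b | s' ≤ |g a b|} := by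
  -- The unit sphere, and with it `K`, is empty when there are no features.
  rcases K.eq_empty_or_nonempty with rfl | hne
  · exact ⟨1, 1 / 2, by norm_num, by norm_num, by norm_num, by simp⟩
  have hga : ∀ a, Continuous (g a) := fun a => hg.comp (Continuous.prodMk_right a)
  have hm : ∀ a, Measurable fun b => min |g a b| 1 := fun a =>
    ((hga a).abs.min continuous_const).measurable
  have hbd : ∀ a b, ‖min |g a b| 1‖ ≤ 1 := fun a b => by
    rw [Real.norm_of_nonneg (le_min (abs_nonneg _) zero_le_one)]
    exact min_le_right _ _
  have hint : ∀ a, Integrable (fun b => min |g a b| 1) Q := fun a =>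
    Integrable.of_bound (hm a).aestronglyMeasurable 1 (Eventually.of_forall (hbd a))
  -- Truncation at `1` permits dominated convergence without integrability of `g`. The minimum `c`
  -- over `K` is positive because the integrand is nonzero with positive probability.
  have hcont : Continuous fun a => ∫ b, min |g a b| 1 ∂Q := by
    refine continuous_of_dominated (bound := fun _ => 1) (fun a => (hm a).aestronglyMeasurable)
      (fun a => Eventually.of_forall (hbd a)) (integrable_const 1) (Eventually.of_forall fun b => ?_)
    exact (hg.comp (Continuous.prodMk_left b)).abs.min continuous_const
  obtain ⟨a₀, ha₀, hmin⟩ := hK.exists_isMinOn hne hcont.continuousOn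
  set c := ∫ b, min |g a₀ b| 1 ∂Q with hc
  have hc0 : 0 < c := by
    rw [hc, integral_pos_iff_support_of_nonneg
      (fun b => le_min (abs_nonneg _) zero_le_one) (hint a₀)]
    have : Function.support (fun b => min |g a₀ b| 1) = {b | g a₀ b ≠ 0} := by
      ext b
      rw [Function.mem_support, Set.mem_ofPred_eq, not_iff_not]
      constructor
      · intro h
        rcases min_choice |g a₀ b| 1 with h' | h'
        · rw [h'] at h
          exact abs_eq_zero.1 h
        · rw [h'] at h
          norm_num at h
      · intro h
        simp [h]
    rw [this]
    exact pos_iff_ne_zero.2 (hpos a₀ ha₀)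
  have hc1 : c ≤ 1 := by
    have := integral_mono (hint a₀) (integrable_const 1) fun b => min_le_right _ _
    simpa using this
  refine ⟨c / 2, c / 2, by linarith, by linarith, by linarith, fun a ha s' hs' => ?_⟩
  have h1 : c ≤ ∫ b, min |g a b| 1 ∂Q := hmin ha
  have hEm : MeasurableSet {b | c / 2 ≤ |g a b|} :=
    measurableSet_le measurable_const (hga a).abs.measurable
  -- The truncated function is at most `c / 2` off the event and at most `1` on it, so the event has
  -- probability at least `c / 2`.
  have h2 : ∫ b, min |g a b| 1 ∂Q ≤
      ∫ b, (c / 2 + {b | c / 2 ≤ |g a b|}.indicator (fun _ => (1 : ℝ)) b) ∂Q := by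
    refine integral_mono (hint a) ((integrable_const _).add ((integrable_const _).indicator hEm))
      fun b => ?_
    by_cases h : c / 2 ≤ |g a b|
    · simp only [Set.mem_ofPred_eq, h, Set.indicator_of_mem]
      exact (min_le_right _ _).trans (by linarith)
    · simp only [Set.mem_ofPred_eq, h, not_false_eq_true, Set.indicator_of_notMem, add_zero]
      exact (min_le_left _ _).trans (not_le.1 h).le
  rw [integral_add (integrable_const _) ((integrable_const _).indicator hEm),
    integral_indicator hEm, setIntegral_const, integral_const] at h2
  simp only [probReal_univ, smul_eq_mul, one_mul, mul_one] at h2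
  refine le_trans (by linarith) (measureReal_mono (μ := Q) (s₁ := {b | c / 2 ≤ |g a b|}) ?_)
  intro b hb
  exact hs'.trans hb

/-- A set which is null for Lebesgue measure does not carry the product of two semi-continuous
laws. -/
theorem SemiContinuousLaw.prod_compl_ne_zero {n k : ℕ} {P : Measure (Vec n)} {P' : Measure (Vec k)}
    [IsProbabilityMeasure P] [IsProbabilityMeasure P'] (hP : SemiContinuousLaw P)
    (hP' : SemiContinuousLaw P') {E : Set (Vec n × Vec k)} (hE : MeasurableSet E)
    (h0 : (volume.prod volume : Measure (Vec n × Vec k)) E = 0) : (P.prod P') Eᶜ ≠ 0 := by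
  intro hcompl
  rw [Measure.measure_prod_null hE] at h0
  rw [Measure.measure_prod_null hE.compl] at hcompl
  -- If `Eᶜ` were null, almost every section of `E` would have full `P'`-mass, hence positive
  -- volume. The set of such base points is Lebesgue-null by Fubini, yet would have full `P`-mass.
  refine hP ⟨{a | ¬ volume (Prod.mk a ⁻¹' E) = 0}, ae_iff.1 h0, ?_⟩
  refine le_antisymm prob_le_one ?_
  have h1 : P {a | P' (Prod.mk a ⁻¹' Eᶜ) = 0} = 1 :=
    (mem_ae_iff_prob_eq_one (measurable_measure_prodMk_left hE.compl (measurableSet_singleton 0))).1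
      hcompl
  rw [← h1]
  refine measure_mono fun a ha => ?_
  intro hvol
  refine hP' ⟨_, hvol, ?_⟩
  have ha' : P' (Prod.mk a ⁻¹' E)ᶜ = 0 := ha
  exact (prob_compl_eq_zero_iff (hE.preimage measurable_prodMk_left)).1 ha'

theorem continuous_featureVec {nx nu m : ℕ} {φ : Fin m → Vec nx × Vec nu → ℝ}
    (hφ : ∀ i, Continuous (φ i)) : Continuous fun q : Vec nx × Vec nu => featureVec φ q.1 q.2 := by
  unfold featureVec
  exact (PiLp.continuous_toLp 2 _).comp (continuous_pi fun i => hφ i)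

theorem continuous_matVec {n m : ℕ} (θ : Matrix (Fin n) (Fin m) ℝ) : Continuous (matVec θ) := by
  unfold matVec
  fun_prop

theorem inner_featureVec {nx nu m : ℕ} (φ : Fin m → Vec nx × Vec nu → ℝ) (v : Vec m) (x : Vec nx)
    (u : Vec nu) : inner ℝ v (featureVec φ x u) = ∑ i, v i * φ i (x, u) := by
  simp [featureVec, PiLp.inner_apply, mul_comm]

/-- Along noisy closed-loop inputs, a nontrivial combination of the features is nonzero with
positive probability. -/
theorem prod_inner_featureVec_ne_zero {nx nu m : ℕ} {φ : Fin m → Vec nx × Vec nu → ℝ}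
    (hφ : ∀ i, AnalyticOnNhd ℝ (φ i) Set.univ) (hφ_indep : LinearIndependent ℝ φ)
    {π : Vec nx → Vec nu} (hπ : AnalyticOnNhd ℝ π Set.univ) {P : Measure (Vec nx)}
    {P' : Measure (Vec nu)} [IsProbabilityMeasure P] [IsProbabilityMeasure P']
    (hP : SemiContinuousLaw P) (hP' : SemiContinuousLaw P') {v : Vec m} (hv : v ≠ 0)
    (z : Vec nx) :
    (P.prod P') {q | inner ℝ v (featureVec φ (z + q.1) (π (z + q.1) + q.2)) ≠ 0} ≠ 0 := by
  set h : Vec nx × Vec nu → ℝ := fun q => inner ℝ v (featureVec φ (z + q.1) (π (z + q.1) + q.2))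
    with hh
  have hana : AnalyticOnNhd ℝ h Set.univ := by
    intro q _
    simp only [hh, inner_featureVec]
    refine Finset.analyticAt_fun_sum _ fun i _ => analyticAt_const.mul ?_
    have h1 : AnalyticAt ℝ (fun q : Vec nx × Vec nu => z + q.1) q :=
      analyticAt_const.add analyticAt_fst
    have h2 : AnalyticAt ℝ (fun q : Vec nx × Vec nu => π (z + q.1)) q :=
      (hπ (z + q.1) (Set.mem_univ _)).comp_of_eq h1 rfl
    exact (hφ i _ (Set.mem_univ _)).comp_of_eq (h1.prod (h2.add analyticAt_snd)) rfl
  have hne : ∃ q, h q ≠ 0 := by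
    by_contra! hzero
    apply hv
    have h0 : ∑ i, v i • φ i = 0 := by
      ext ⟨x, u⟩
      -- The map `(w, η) ↦ (z + w, π (z + w) + η)` is onto, with this preimage of `(x, u)`;
      -- vanishing along the noise therefore forces a linear relation among the features.
      have := hzero (x - z, u - π x)
      simp only [hh, inner_featureVec, add_sub_cancel] at this
      simpa using this
    ext i
    exact Fintype.linearIndependent_iff.1 hφ_indep _ h0 i
  obtain ⟨q₀, hq₀⟩ := hne
  have hcont : Continuous h := continuousOn_univ.1 hana.continuousOn
  exact hP.prod_compl_ne_zero hP' (E := {q | h q = 0})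
    (isClosed_eq hcont continuous_const).measurableSet (hana.addHaar_zeroSet _ hq₀)

theorem norm_le_of_abs_le {n : ℕ} {v : Vec n} {B : ℝ} (h : ∀ i, |v i| ≤ B) : ‖v‖ ≤ √n * |B| := by
  rw [EuclideanSpace.norm_eq, ← Real.sqrt_sq (abs_nonneg B), ← Real.sqrt_mul (Nat.cast_nonneg n)]
  refine Real.sqrt_le_sqrt ?_
  calc ∑ i, ‖v i‖ ^ 2 ≤ ∑ _i : Fin n, |B| ^ 2 := Finset.sum_le_sum fun i _ => by
        rw [Real.norm_eq_abs]
        exact pow_le_pow_left₀ (abs_nonneg _) ((h i).trans (le_abs_self B)) 2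
    _ = n * |B| ^ 2 := by simp

/-- Hoeffding's lemma for a bounded centred variable. The constant comes from the bound `B`, not
from the covariance level `σ`; adding `1` keeps it positive. -/
theorem BoundedIIDSemiContinuous.exists_subgaussianVec {Ω : Type*} [MeasurableSpace Ω]
    {μ : Measure Ω} [IsProbabilityMeasure μ] {n : ℕ} {ξ : ℕ → Ω → Vec n} {σ B : ℝ}
    (h : BoundedIIDSemiContinuous μ ξ σ B) : ∃ σ', 0 < σ' ∧ ∀ t, SubgaussianVec μ (ξ t) σ' := by
  refine ⟨√n * |B| + 1, by positivity, fun t v hv => ?_⟩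
  set C := √n * |B| + 1 with hC
  have hC0 : 0 < C := by positivity
  have hbd : ∀ᵐ ω ∂μ, ‖ξ t ω‖ ≤ C := by
    filter_upwards [h.bounded t] with ω hω
    exact (norm_le_of_abs_le hω).trans (by linarith)
  have hi : Integrable (ξ t) μ := Integrable.of_bound (h.measurable t).aestronglyMeasurable C hbd
  have hm : Measurable fun ω => (inner ℝ v (ξ t ω) : ℝ) := by
    have := h.measurable t
    fun_prop
  have h1 := hasSubgaussianMGF_of_mem_Icc_of_integral_eq_zero (μ := μ) (a := -C) (b := C)
    hm.aemeasurable (by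
      filter_upwards [hbd] with ω hω
      rw [Set.mem_Icc, ← abs_le]
      exact (abs_real_inner_le_norm _ _).trans (by rw [hv, one_mul]; exact hω))
    (by rw [integral_inner hi v, h.mean_zero t, inner_zero_right])
  convert h1 using 1
  ext
  rw [Real.coe_toNNReal _ (sq_nonneg C)]
  push_cast
  rw [Real.norm_of_nonneg (by linarith)]
  ring

/-! ### The closed-loop system: measurability, independence, boundedness -/

section System

variable {Ω : Type*} {nx nu m : ℕ}
  {θ : Matrix (Fin nx) (Fin m) ℝ} {φ : Fin m → Vec nx × Vec nu → ℝ} {π : Vec nx → Vec nu}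
  {w x : ℕ → Ω → Vec nx} {η u : ℕ → Ω → Vec nu}

/-- The σ-algebra is left free: both the ambient one and the one generated by finitely many past
noises occur. -/
theorem measurable_state (hφ : ∀ i, Continuous (φ i)) (hπ : Continuous π)
    (hx_zero : ∀ ω, x 0 ω = 0) (hu : ∀ t ω, u t ω = π (x t ω) + η t ω)
    (hx : ∀ t ω, x (t + 1) ω = matVec θ (featureVec φ (x t ω) (u t ω)) + w t ω)
    {mΩ : MeasurableSpace Ω} {T : ℕ} (hw : ∀ t < T, Measurable[mΩ] (w t))
    (hη : ∀ t < T, Measurable[mΩ] (η t)) : ∀ t ≤ T, Measurable[mΩ] (x t) := by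
  intro t
  induction t with
  | zero =>
    intro _
    rw [funext hx_zero]
    exact measurable_const
  | succ t ih =>
    intro ht
    have hxt := ih (by omega)
    have hut : Measurable[mΩ] (u t) := by
      rw [funext (hu t)]
      exact (hπ.measurable.comp hxt).add (hη t (by omega))
    rw [funext (hx t)]
    exact ((continuous_matVec θ).measurable.comp
      ((continuous_featureVec hφ).measurable.comp (hxt.prodMk hut))).add (hw t (by omega))

theorem measurable_dataSigma_noise (w x : ℕ → Ω → Vec nx) (π : Vec nx → Vec nu)
    (η : ℕ → Ω → Vec nu) {i t : ℕ} (h : i < t) : Measurable[dataSigma w x π η t] (w i) :=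
  measurable_iff_comap_le.2 (le_sup_of_le_left (le_sup_of_le_left (le_sup_of_le_left
    (le_iSup (fun j : Fin t => MeasurableSpace.comap (w j) inferInstance) ⟨i, h⟩))))

theorem measurable_dataSigma_state (w x : ℕ → Ω → Vec nx) (π : Vec nx → Vec nu)
    (η : ℕ → Ω → Vec nu) {i t : ℕ} (h : i ≤ t) : Measurable[dataSigma w x π η t] (x i) :=
  measurable_iff_comap_le.2 (le_sup_of_le_left (le_sup_of_le_left (le_sup_of_le_right
    (le_iSup (fun j : Fin (t + 1) => MeasurableSpace.comap (x j) inferInstance)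
      ⟨i, Nat.lt_succ_of_le h⟩))))

theorem measurable_dataSigma_input (w x : ℕ → Ω → Vec nx) (π : Vec nx → Vec nu)
    (η : ℕ → Ω → Vec nu) {i t : ℕ} (h : i ≤ t) : Measurable[dataSigma w x π η t] (η i) :=
  measurable_iff_comap_le.2 (le_sup_of_le_right
    (le_iSup (fun j : Fin (t + 1) => MeasurableSpace.comap (η j) inferInstance)
      ⟨i, Nat.lt_succ_of_le h⟩))

theorem dataSigma_le (hπ : Continuous π) {mΩ : MeasurableSpace Ω} {t : ℕ}
    (hw : ∀ i < t, Measurable[mΩ] (w i)) (hx : ∀ i ≤ t, Measurable[mΩ] (x i))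
    (hη : ∀ i ≤ t, Measurable[mΩ] (η i)) : dataSigma w x π η t ≤ mΩ := by
  refine sup_le (sup_le (sup_le ?_ ?_) ?_) ?_ <;> refine iSup_le fun i => ?_
  · exact (hw i i.2).comap_le
  · exact (hx i (Nat.le_of_lt_succ i.2)).comap_le
  · exact (hπ.measurable.comp (hx i (Nat.le_of_lt_succ i.2))).comap_le
  · exact (hη i (Nat.le_of_lt_succ i.2)).comap_le

theorem measurable_dataSigma_feature (hφ : ∀ i, Continuous (φ i)) (hπ : Continuous π)
    (hu : ∀ t ω, u t ω = π (x t ω) + η t ω) {i t : ℕ} (h : i ≤ t) :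
    Measurable[dataSigma w x π η t] fun ω => featureVec φ (x i ω) (u i ω) := by
  have hxt := measurable_dataSigma_state w x π η h
  have hut : Measurable[dataSigma w x π η t] (u i) := by
    rw [funext (hu i)]
    exact (hπ.measurable.comp hxt).add (measurable_dataSigma_input w x π η h)
  exact (continuous_featureVec hφ).measurable.comp (hxt.prodMk hut)

/-- The data up to time `t` are independent of the next pair `(w_t, η_{t+1})`, whose components
are independent. -/
theorem indep_dataSigma [MeasurableSpace Ω] {μ : Measure Ω} [IsProbabilityMeasure μ]
    (hφ : ∀ i, Continuous (φ i)) (hπ : Continuous π)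
    (hx_zero : ∀ ω, x 0 ω = 0) (hu : ∀ t ω, u t ω = π (x t ω) + η t ω)
    (hx : ∀ t ω, x (t + 1) ω = matVec θ (featureVec φ (x t ω) (u t ω)) + w t ω)
    (hwm : ∀ t, Measurable (w t)) (hηm : ∀ t, Measurable (η t)) (hwi : iIndepFun w μ)
    (hηi : iIndepFun η μ) (hwη : IndepFun (fun ω t => w t ω) (fun ω t => η t ω) μ) (t : ℕ) :
    Indep (dataSigma w x π η t)
      (MeasurableSpace.comap (fun ω => (w t ω, η (t + 1) ω)) inferInstance) μ := by
  -- The indices are shifted: the data at time `t` contain `η_t` but not `w_t`, so the fresh pair is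
  -- `(w_t, η_{t+1})`.
  have hw' := (hwi.indepFun_finset (Finset.range t) {t} (by simp) hwm).comp measurable_id
    (measurable_pi_apply (⟨t, Finset.mem_singleton_self t⟩ : ({t} : Finset ℕ)))
  have hη' := (hηi.indepFun_finset (Finset.range (t + 1)) {t + 1} (by simp) hηm).comp measurable_id
    (measurable_pi_apply (⟨t + 1, Finset.mem_singleton_self _⟩ : ({t + 1} : Finset ℕ)))
  have hX₁ : Measurable fun ω (i : Finset.range t) => w i ω := measurable_pi_lambda _ fun i => hwm i
  have hY₁ : Measurable fun ω (i : Finset.range (t + 1)) => η i ω :=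
    measurable_pi_lambda _ fun i => hηm i
  have hpair := hwη.comp
    (φ := fun f : ℕ → Vec nx => ((fun i : Finset.range t => f i), f t))
    (ψ := fun f : ℕ → Vec nu => ((fun i : Finset.range (t + 1) => f i), f (t + 1)))
    (by fun_prop) (by fun_prop)
  have hmain := IndepFun.prodMk_prodMk_swap hX₁ (hwm t) hY₁ (hηm (t + 1)) hw' hη' hpair
  refine indep_of_indep_of_le_left hmain ?_
  -- Every generator of the data σ-algebra is a function of these past noises.
  set past : Ω → (Finset.range t → Vec nx) × (Finset.range (t + 1) → Vec nu) :=
    fun ω => (fun i => w i ω, fun i => η i ω) with hpast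
  have hp : Measurable[MeasurableSpace.comap past inferInstance] past := comap_measurable past
  have hwP : ∀ i < t, Measurable[MeasurableSpace.comap past inferInstance] (w i) := fun i hi =>
    Measurable.comp (g := fun q : (Finset.range t → Vec nx) × (Finset.range (t + 1) → Vec nu) =>
      q.1 ⟨i, Finset.mem_range.2 hi⟩) (by fun_prop) hp
  have hηP : ∀ i ≤ t, Measurable[MeasurableSpace.comap past inferInstance] (η i) := fun i hi =>
    Measurable.comp (g := fun q : (Finset.range t → Vec nx) × (Finset.range (t + 1) → Vec nu) =>
      q.2 ⟨i, Finset.mem_range.2 (Nat.lt_succ_of_le hi)⟩) (by fun_prop) hp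
  exact dataSigma_le hπ hwP
    (measurable_state hφ hπ hx_zero hu hx hwP fun i hi => hηP i hi.le) hηP

theorem state_eq_trajectory (hx_zero : ∀ ω, x 0 ω = 0) (hu : ∀ t ω, u t ω = π (x t ω) + η t ω)
    (hx : ∀ t ω, x (t + 1) ω = matVec θ (featureVec φ (x t ω) (u t ω)) + w t ω) (ω : Ω) (t : ℕ) :
    x t ω = trajectory (closedLoop θ φ π) 0
      (fun t => Sum.elim (fun i => w t ω i) (fun i => η t ω i)) t := by
  induction t with
  | zero => simp [trajectory, hx_zero]
  | succ t ih =>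
    rw [trajectory, ← ih, hx, hu]
    rfl

/-- Outside a null set the noise path is an admissible deterministic input, and the zero initial
state kills the `β` term, leaving the bound `γ(ρ)`. -/
theorem exists_state_bound [MeasurableSpace Ω] {μ : Measure Ω}
    {ρx ρ wmax umax : ℝ} (hLISS : IsLISS (closedLoop θ φ π) ρx ρ)
    (hρ : max wmax umax ≤ ρ) (hwb : ∀ t, ∀ᵐ ω ∂μ, ∀ i, |w t ω i| ≤ wmax)
    (hηb : ∀ t, ∀ᵐ ω ∂μ, ∀ i, |η t ω i| ≤ umax) (hx_zero : ∀ ω, x 0 ω = 0)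
    (hu : ∀ t ω, u t ω = π (x t ω) + η t ω)
    (hx : ∀ t ω, x (t + 1) ω = matVec θ (featureVec φ (x t ω) (u t ω)) + w t ω) :
    ∃ C, ∀ᵐ ω ∂μ, ∀ t, ‖x t ω‖ ≤ C := by
  obtain ⟨-, -, hρx, hρ0, γ, β, hγ, hβ, hbd⟩ := hLISS
  refine ⟨γ ρ.toNNReal, ?_⟩
  filter_upwards [ae_all_iff.2 hwb, ae_all_iff.2 hηb] with ω hωw hωη t
  have hd : ∀ t, ‖(Sum.elim (fun i => w t ω i) (fun i => η t ω i) : Fin nx ⊕ Fin nu → ℝ)‖ ≤ ρ := by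
    intro t
    rw [pi_norm_le_iff_of_nonneg hρ0.le]
    rintro (i | i)
    · exact (hωw t i).trans ((le_max_left _ _).trans hρ)
    · exact (hωη t i).trans ((le_max_right _ _).trans hρ)
  have h1 := hbd 0 _ (by simpa using hρx.le) hd t
  rw [← state_eq_trajectory hx_zero hu hx, nnnorm_zero, (hβ.classK t).zero, zero_add] at h1
  refine NNReal.coe_le_coe.2 (h1.trans (hγ.strictMono.monotone (ciSup_le fun j => ?_)))
  rw [← norm_toNNReal]
  exact Real.toNNReal_le_toNNReal (hd j)

theorem exists_feature_bound [MeasurableSpace Ω] {μ : Measure Ω}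
    (hφ : ∀ i, Continuous (φ i)) (hπ : Continuous π) {C umax : ℝ}
    (hC : ∀ᵐ ω ∂μ, ∀ t, ‖x t ω‖ ≤ C) (hηb : ∀ t, ∀ᵐ ω ∂μ, ∀ i, |η t ω i| ≤ umax)
    (hu : ∀ t ω, u t ω = π (x t ω) + η t ω) :
    ∃ D, ∀ᵐ ω ∂μ, ∀ t, ‖featureVec φ (x t ω) (u t ω)‖ ≤ D := by
  have hcont : Continuous fun q : Vec nx × Vec nu => featureVec φ q.1 (π q.1 + q.2) :=
    (continuous_featureVec hφ).comp (continuous_fst.prodMk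
      ((hπ.comp continuous_fst).add continuous_snd))
  obtain ⟨D, hD⟩ := ((isCompact_closedBall (0 : Vec nx) C).prod
    (isCompact_closedBall (0 : Vec nu) (√nu * |umax|))).exists_bound_of_continuousOn
      hcont.continuousOn
  refine ⟨D, ?_⟩
  filter_upwards [hC, ae_all_iff.2 hηb] with ω hω hωη t
  rw [hu]
  exact hD (x t ω, η t ω) ⟨by simpa using hω t, by simpa using norm_le_of_abs_le (hωη t)⟩

end System

/-! ### Small-ball condition for the features and conclusion -/

/-- Conditionally on the data, only `(w_t, η_{t+1})` is random, and the parameter `θ φ(x_t, u_t)`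
lies almost surely in the compact image of a ball of radius `D`. One `p` serves all smaller levels
`s'`, which later allows `s` to be shrunk. -/
theorem exists_isBMSB {Ω : Type*} [MeasurableSpace Ω] {μ : Measure Ω} [IsProbabilityMeasure μ]
    {nx nu m : ℕ} {θ : Matrix (Fin nx) (Fin m) ℝ} {φ : Fin m → Vec nx × Vec nu → ℝ}
    (hφ : ∀ i, AnalyticOnNhd ℝ (φ i) Set.univ) (hφ_indep : LinearIndependent ℝ φ)
    {π : Vec nx → Vec nu} (hπ : AnalyticOnNhd ℝ π Set.univ) {w x : ℕ → Ω → Vec nx}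
    {η u : ℕ → Ω → Vec nu} {σw wmax σu umax : ℝ} (hw : BoundedIIDSemiContinuous μ w σw wmax)
    (hη : BoundedIIDSemiContinuous μ η σu umax)
    (hwη : IndepFun (fun ω t => w t ω) (fun ω t => η t ω) μ) (hx_zero : ∀ ω, x 0 ω = 0)
    (hu : ∀ t ω, u t ω = π (x t ω) + η t ω)
    (hx : ∀ t ω, x (t + 1) ω = matVec θ (featureVec φ (x t ω) (u t ω)) + w t ω) {D : ℝ}
    (hD : ∀ᵐ ω ∂μ, ∀ t, ‖featureVec φ (x t ω) (u t ω)‖ ≤ D) :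
    ∃ s p : ℝ, 0 < s ∧ 0 < p ∧ p < 1 ∧ ∀ s', 0 < s' → s' ≤ s →
      IsBMSB μ (dataSigma w x π η) (fun t ω => featureVec φ (x t ω) (u t ω)) 1
        (s' ^ 2 • (1 : Matrix (Fin m) (Fin m) ℝ)) p := by
  have hφc : ∀ i, Continuous (φ i) := fun i => continuousOn_univ.1 (hφ i).continuousOn
  have hπc : Continuous π := continuousOn_univ.1 hπ.continuousOn
  have hxm : ∀ t, Measurable (x t) := fun t =>
    measurable_state hφc hπc hx_zero hu hx (fun i _ => hw.measurable i)
      (fun i _ => hη.measurable i) t le_rfl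
  have hle : ∀ t, dataSigma w x π η t ≤ ‹MeasurableSpace Ω› := fun t =>
    dataSigma_le hπc (fun i _ => hw.measurable i) (fun i _ => hxm i) (fun i _ => hη.measurable i)
  have hlaw : ∀ t, μ.map (fun ω => (w t ω, η (t + 1) ω)) = (μ.map (w 0)).prod (μ.map (η 0)) := by
    intro t
    have hi : IndepFun (w t) (η (t + 1)) μ :=
      hwη.comp (measurable_pi_apply t) (measurable_pi_apply (t + 1))
    rw [hi.map_prod_eq_prod_map_map (hw.measurable t).aemeasurable
      (hη.measurable (t + 1)).aemeasurable, (hw.identDistrib t).map_eq,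
      (hη.identDistrib (t + 1)).map_eq]
  have hPw : IsProbabilityMeasure (μ.map (w 0)) :=
    Measure.isProbabilityMeasure_map (hw.measurable 0).aemeasurable
  have hPη : IsProbabilityMeasure (μ.map (η 0)) :=
    Measure.isProbabilityMeasure_map (hη.measurable 0).aemeasurable
  let g : Vec m × Vec nx → Vec nx × Vec nu → ℝ := fun a q =>
    inner ℝ a.1 (featureVec φ (a.2 + q.1) (π (a.2 + q.1) + q.2))
  have hg : Continuous fun q : (Vec m × Vec nx) × (Vec nx × Vec nu) => g q.1 q.2 := by
    refine Continuous.inner (by fun_prop) ((continuous_featureVec hφc).comp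
      (Continuous.prodMk (by fun_prop) (by fun_prop)))
  have hK : IsCompact (Metric.sphere (0 : Vec m) 1 ×ˢ (matVec θ '' Metric.closedBall 0 D)) :=
    (isCompact_sphere 0 1).prod ((isCompact_closedBall 0 D).image (continuous_matVec θ))
  obtain ⟨s, p, hs, hp, hp1, hball⟩ := exists_uniform_smallBall
    (Q := (μ.map (w 0)).prod (μ.map (η 0))) hg hK (fun a ha =>
      prod_inner_featureVec_ne_zero hφ hφ_indep hπ (hw.semiContinuous 0) (hη.semiContinuous 0)
        (norm_ne_zero_iff.1 (by rw [mem_sphere_zero_iff_norm.1 ha.1]; exact one_ne_zero)) a.2)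
  refine ⟨s, p, hs, hp, hp1, fun s' hs' hss => ⟨fun t _ => hle t, fun t₁ t₂ _ h12 => ?_,
    fun t _ => measurable_dataSigma_feature hφc hπc hu le_rfl, one_pos,
    Matrix.PosDef.one.smul (by positivity), ⟨hp.le, hp1.le⟩, fun v hv t _ => ?_⟩⟩
  · exact dataSigma_le hπc (fun i hi => measurable_dataSigma_noise w x π η (hi.trans_le h12))
      (fun i hi => measurable_dataSigma_state w x π η (hi.trans h12))
      (fun i hi => measurable_dataSigma_input w x π η (hi.trans h12))
  · have hS : MeasurableSet {q : Vec nx × (Vec nx × Vec nu) | s' ≤ |g (v, q.1) q.2|} :=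
      measurableSet_le measurable_const (hg.comp (f := fun q : Vec nx × (Vec nx × Vec nu) =>
        ((v, q.1), q.2)) (by fun_prop)).abs.measurable
    have hcond := le_condProb_of_indep (μ := μ) (hle t)
      (X := fun ω => matVec θ (featureVec φ (x t ω) (u t ω)))
      ((continuous_matVec θ).measurable.comp (measurable_dataSigma_feature hφc hπc hu le_rfl))
      (N := fun ω => (w t ω, η (t + 1) ω)) ((hw.measurable t).prodMk (hη.measurable (t + 1)))
      (indep_dataSigma hφc hπc hx_zero hu hx hw.measurable hη.measurable hw.indep hη.indep hwη t)
      hS (K := matVec θ '' Metric.closedBall 0 D) (by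
        filter_upwards [hD] with ω hω
        exact ⟨_, by simpa using hω t, rfl⟩) (p := p) (fun z hz => by
        rw [hlaw]
        exact hball (v, z) ⟨by simpa using hv, hz⟩ s' hss)
    have hset : {ω' | (matVec θ (featureVec φ (x t ω') (u t ω')), (w t ω', η (t + 1) ω')) ∈
        {q : Vec nx × (Vec nx × Vec nu) | s' ≤ |g (v, q.1) q.2|}} =
        {ω' | s' ≤ |inner ℝ v (featureVec φ (x (t + 1) ω') (u (t + 1) ω'))|} := by
      ext ω
      simp only [Set.mem_ofPred_eq, g, hu (t + 1), hx t]
    rw [hset] at hcond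
    simpa [sqrt_dotProduct_sq_smul_one hs'.le hv] using hcond

theorem corollary1 {Ω : Type*} [MeasurableSpace Ω] (μ : Measure Ω) [IsProbabilityMeasure μ]
    {nx nu nφ : ℕ}
    -- the system: real-analytic, linearly independent features and a real-analytic policy
    (θ : Matrix (Fin nx) (Fin nφ) ℝ)
    (φ : Fin nφ → Vec nx × Vec nu → ℝ)
    (hφ : ∀ i, AnalyticOnNhd ℝ (φ i) Set.univ)
    (hφ_indep : LinearIndependent ℝ φ)
    (π : Vec nx → Vec nu)
    (hπ : AnalyticOnNhd ℝ π Set.univ)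
    -- the disturbances and the input noise
    (w : ℕ → Ω → Vec nx) (η : ℕ → Ω → Vec nu)
    (σw wmax σu umax : ℝ)
    (hw : BoundedIIDSemiContinuous μ w σw wmax)
    (hη : BoundedIIDSemiContinuous μ η σu umax)
    (hwη : IndepFun (fun ω t => w t ω) (fun ω t => η t ω) μ)
    -- the closed loop is LISS with respect to `(w, η)`
    (ρx ρ : ℝ)
    (hLISS : IsLISS (closedLoop θ φ π) ρx ρ)
    (hρ : max wmax umax ≤ ρ)
    -- states and inputs
    (x : ℕ → Ω → Vec nx) (u : ℕ → Ω → Vec nu)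
    (hx_zero : ∀ ω, x 0 ω = 0)
    (hu : ∀ t ω, u t ω = π (x t ω) + η t ω)
    (hx : ∀ t ω, x (t + 1) ω = matVec θ (featureVec φ (x t ω) (u t ω)) + w t ω) :
    -- `b = sup_t E ‖φ(x_t, u_t)‖²` is a supremum of finite expectations and is finite
    (∀ t, Integrable (fun ω => ‖featureVec φ (x t ω) (u t ω)‖ ^ 2) μ) ∧
    BddAbove (Set.range fun t => ∫ ω, ‖featureVec φ (x t ω) (u t ω)‖ ^ 2 ∂μ) ∧
    -- there are small-ball constants, for which the error bound holds with noise level `σw`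
    (∃ s p : ℝ, 0 < s ∧ 0 < p ∧ p < 1 ∧
      IsBMSB μ (dataSigma w x π η) (fun t ω => featureVec φ (x t ω) (u t ω)) 1
        (s ^ 2 • (1 : Matrix (Fin nφ) (Fin nφ) ℝ)) p ∧
      LSERate μ θ x (fun t ω => featureVec φ (x t ω) (u t ω)) s p
        (⨆ t, ∫ ω, ‖featureVec φ (x t ω) (u t ω)‖ ^ 2 ∂μ) σw) ∧
    -- for all small-ball constants, the error bound holds with any sub-Gaussian noise level
    (∀ s p σ : ℝ, 0 < s → 0 < p → p < 1 → 0 < σ →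
      IsBMSB μ (dataSigma w x π η) (fun t ω => featureVec φ (x t ω) (u t ω)) 1
        (s ^ 2 • (1 : Matrix (Fin nφ) (Fin nφ) ℝ)) p →
      (∀ t, SubgaussianVec μ (w t) σ) →
      LSERate μ θ x (fun t ω => featureVec φ (x t ω) (u t ω)) s p
        (⨆ t, ∫ ω, ‖featureVec φ (x t ω) (u t ω)‖ ^ 2 ∂μ) σ) := by
  have hφc : ∀ i, Continuous (φ i) := fun i => continuousOn_univ.1 (hφ i).continuousOn
  have hπc : Continuous π := continuousOn_univ.1 hπ.continuousOn
  obtain ⟨C, hC⟩ := exists_state_bound hLISS hρ hw.bounded hη.bounded hx_zero hu hx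
  obtain ⟨D, hD⟩ := exists_feature_bound hφc hπc hC hη.bounded hu
  have hxm : ∀ t, Measurable (x t) := fun t =>
    measurable_state hφc hπc hx_zero hu hx (fun i _ => hw.measurable i)
      (fun i _ => hη.measurable i) t le_rfl
  have hle : ∀ t, dataSigma w x π η t ≤ ‹MeasurableSpace Ω› := fun t =>
    dataSigma_le hπc (fun i _ => hw.measurable i) (fun i _ => hxm i) (fun i _ => hη.measurable i)
  have hym : ∀ t, Measurable fun ω => featureVec φ (x t ω) (u t ω) := fun t =>
    (measurable_dataSigma_feature (w := w) hφc hπc hu le_rfl).mono (hle t) le_rfl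
  have hbd : ∀ t, ∀ᵐ ω ∂μ, ‖featureVec φ (x t ω) (u t ω)‖ ^ 2 ≤ D ^ 2 := fun t => by
    filter_upwards [hD] with ω hω
    exact pow_le_pow_left₀ (norm_nonneg _) (hω t) 2
  have hyi : ∀ t, Integrable (fun ω => ‖featureVec φ (x t ω) (u t ω)‖ ^ 2) μ := fun t => by
    refine Integrable.of_bound ((hym t).norm.pow_const 2).aestronglyMeasurable (D ^ 2) ?_
    filter_upwards [hbd t] with ω hω
    rwa [Real.norm_of_nonneg (by positivity)]
  have hbdd : BddAbove (Set.range fun t => ∫ ω, ‖featureVec φ (x t ω) (u t ω)‖ ^ 2 ∂μ) := by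
    refine ⟨D ^ 2, ?_⟩
    rintro _ ⟨t, rfl⟩
    simpa using integral_mono_ae (hyi t) (integrable_const (D ^ 2)) (hbd t)
  have hrate : ∀ s p σ : ℝ, 0 < s → 0 < p → p < 1 → 0 < σ →
      IsBMSB μ (dataSigma w x π η) (fun t ω => featureVec φ (x t ω) (u t ω)) 1
        (s ^ 2 • (1 : Matrix (Fin nφ) (Fin nφ) ℝ)) p →
      (∀ t, SubgaussianVec μ (w t) σ) →
      LSERate μ θ x (fun t ω => featureVec φ (x t ω) (u t ω)) s p
        (⨆ t, ∫ ω, ‖featureVec φ (x t ω) (u t ω)‖ ^ 2 ∂μ) σ := by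
    intro s p σ hs hp hp1 hσ hsb hsub
    refine lseRate_of_isBMSB hx hyi (fun t => le_ciSup hbdd t) hs hp hp1 hσ hsb hle
      (fun i t hit => measurable_dataSigma_feature hφc hπc hu hit)
      (fun i t hit => measurable_dataSigma_noise w x π η hit) hw.measurable (fun t => ?_) hsub
    refine indep_of_indep_of_le_right (indep_dataSigma hφc hπc hx_zero hu hx hw.measurable
      hη.measurable hw.indep hη.indep hwη t) ?_
    -- For the martingale transform only the component `w_t` of the fresh pair matters.
    exact (measurable_fst.comp (comap_measurable fun ω => (w t ω, η (t + 1) ω))).comap_le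
  refine ⟨hyi, hbdd, ?_, hrate⟩
  obtain ⟨s, p, hs, hp, hp1, hsb⟩ := exists_isBMSB hφ hφ_indep hπ hw hη hwη hx_zero hu hx hD
  obtain ⟨σ, hσ, hsub⟩ := hw.exists_subgaussianVec
  have hσw := hw.sigma_pos
  -- The factor `σw / σ` ensures `σ / s ≤ σw / s'`, and the minimum with `1` ensures `s' ≤ s`.
  set s' : ℝ := s * min 1 (σw / σ) with hs'
  have hs'0 : 0 < s' := by positivity
  have hs's : s' ≤ s := mul_le_of_le_one_right hs.le (min_le_left _ _)
  refine ⟨s', p, hs'0, hp, hp1, hsb s' hs'0 hs's,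
    (hrate s p σ hs hp hp1 hσ (hsb s hs le_rfl) hsub).mono hs'0 hs's hp
      (Real.iSup_nonneg fun t => integral_nonneg fun ω => by positivity) hσw.le ?_⟩
  rw [div_le_div_iff₀ hs hs'0]
  calc σ * s' ≤ σ * (s * (σw / σ)) := by
        rw [hs']
        gcongr
        exact min_le_right _ _
    _ = σw * s := by field_simp
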